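/- Let $T$ be a triangulation, with fixed connectivity, of a closed connected oriented surface of genus $g$, with $N_0$ vertices, $N_1$ edges and $N_2$ triangles (so $N_0-N_1+N_2=2-2g$; loops and multiple edges are allowed). For a vertex $k$ let $q(k)$ be the number of triangle corners at $k$, and assume $q(k)\ge 3$ for all $k$. Let $a>0$. A Regge triangulation on $T$ is an assignment $l$ of lengths to the $N_1$ edges such that in every triangle the strict triangle inequalities hold; the dynamical triangulation is $l\equiv a$. The barycentrically dual polytope $\mathfrak P(l)$ of $l$ is the dual trivalent ribbon graph, with one polygonal 2-cell for every vertex, whose half-edges (joining the barycenter of a triangle to the midpoint of one of its sides) carry their Euclidean lengths; the side of the polygon dual to $k$ that crosses an edge of $T$ has as its length $L$ the sum of the lengths of the two half-edges that cross this edge. Let $\mathrm{Aut}_\partial(P)$ be the finite group of automorphisms of the edge-refined ribbon graph that preserve every boundary component; it acts on lengths by permutation. A polytope is isoperimetric if for every $k$ the side lengths $L_1(k),\dots,L_{q(k)}(k)$ of the polygon dual to $k$ satisfy $$\sum_{\alpha=1}^{q(k)}L_\alpha(k)=\tfrac{\sqrt3}{3}a\,q(k),\qquad 0<L_\alpha(k)\le\tfrac{\sqrt3}{6}a\,q(k).$$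 Let $\mathfrak{RG}[P]$ be the set of isoperimetric polytopes that are dual to Regge triangulations (the union, over all $\{\delta_k\}$, of the isoperimetric deformations that vary $\delta_k$ sides of the $k$-th equilateral polygon), and $\mathfrak{RG}[T]$ the set of Regge triangulations with isoperimetric dual polytope, both modulo $\mathrm{Aut}_\partial(P)$. Then: 1. The map $\mathfrak P$ induces a homeomorphism $\mathfrak{RG}[T]\to\mathfrak{RG}[P]$. 2. $N_1-N_0=2N_0+6g-6$. 3. Around the given dynamical triangulation both spaces are differentiable orbifolds modelled on $\mathbb R_+^{N_1-N_0}/\mathrm{Aut}_\partial(P)$, and $\mathfrak P$ is an isomorphism of orbifolds: $l\equiv a$ has arbitrarily small $\mathrm{Aut}_\partial(P)$-invariant open neighbourhoods $W$ such that the set of $l\in W$ with isoperimetric dual is an embedded submanifold, equivariantly diffeomorphic to $\mathbb R_+^{N_1-N_0}$ with some smooth action of $\mathrm{Aut}_\partial(P)$, and $\mathfrak P$ maps it equivariantly and diffeomorphically onto an embedded submanifold that is open in the set of isoperimetric Regge polytopes. 4. These orbifolds carry the closed 2-form $$\Omega=\sum_{k}\Big[\tfrac{\sqrt3}{3}a\,q(k)\Big]^2\varpi(k),\qquad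 \varpi(k)=\Big[\tfrac{\sqrt3}{3}a\,q(k)\Big]^{-2}\sum_{1\le\alpha\le\beta\le q(k)-1}dL_\alpha(k)\wedge dL_\beta(k),$$ where the sides of each polygon are numbered counterclockwise: the restriction of $\Omega$ to the isoperimetric deformations does not depend on the choice of the first sides and is invariant under $\mathrm{Aut}_\partial(P)$, and the form on $\mathfrak{RG}[T]$ is the pullback under $\mathfrak P$ of the form on $\mathfrak{RG}[P]$. -/

import Mathlib

open scoped ContDiff Topology

universe u

/-- A triangulated closed connected oriented surface with fixed connectivity, given by its darts
(equivalently: a connected trivalent ribbon graph, given by its half-edges).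

A dart is a side of a triangle, directed so that the triangle lies on its left. `rot d` is the
counterclockwise next side of the same triangle, and `flip d` is the same edge with the opposite
direction, i.e. as a side of the neighbouring triangle. Loops and multiple edges are allowed.
In the dual trivalent graph a dart `d` is the half-edge that joins the barycenter of the triangle
of `d` to the midpoint of `d`; these half-edges are the edges of the edge-refinement. -/
structure TriangulatedSurface where
  /-- the darts -/
  Dart : Type u
  [fintypeDart : Fintype Dart]
  [nonemptyDart : Nonempty Dart]
  /-- next side of the same triangle -/
  rot : Equiv.Perm Dart
  /-- the same edge, seen from the neighbouring triangle -/
  flip : Equiv.Perm Dart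
  rot_rot_rot : ∀ d, rot (rot (rot d)) = d
  rot_ne : ∀ d, rot d ≠ d
  flip_flip : ∀ d, flip (flip d) = d
  flip_ne : ∀ d, flip d ≠ d
  connected : ∀ d e : Dart, ∃ f ∈ Subgroup.closure {rot, flip}, f d = e

attribute [instance] TriangulatedSurface.fintypeDart TriangulatedSurface.nonemptyDart

noncomputable section

namespace TriangulatedSurface

variable (T : TriangulatedSurface.{u})

/-! ### Cells -/

/-- The dart that follows `d` in the counterclockwise order around the tail of `d`. -/
def next : Equiv.Perm T.Dart := T.flip * T.rot⁻¹

/-- The vertices of the triangulation (the boundary components of the dual ribbon graph):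
cycles of darts with a common tail. They serve as their own labels. -/
def Vertex : Type u := Quotient (Equiv.Perm.SameCycle.setoid T.next)

/-- The (unoriented) edges. -/
def Edge : Type u := Quotient (Equiv.Perm.SameCycle.setoid T.flip)

/-- The triangles. -/
def Face : Type u := Quotient (Equiv.Perm.SameCycle.setoid T.rot)

instance : Finite T.Vertex := inferInstanceAs (Finite (Quotient _))
instance : Finite T.Edge := inferInstanceAs (Finite (Quotient _))
instance : Finite T.Face := inferInstanceAs (Finite (Quotient _))
instance : Fintype T.Vertex := Fintype.ofFinite _
instance : Fintype T.Edge := Fintype.ofFinite _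
instance : Fintype T.Face := Fintype.ofFinite _

/-- The tail of a dart. -/
def vertex (d : T.Dart) : T.Vertex := Quotient.mk _ d

/-- The edge that underlies a dart. -/
def edge (d : T.Dart) : T.Edge := Quotient.mk _ d

/-- The number of vertices. -/
def N₀ : ℕ := Fintype.card T.Vertex
/-- The number of edges. -/
def N₁ : ℕ := Fintype.card T.Edge
/-- The number of triangles. -/
def N₂ : ℕ := Fintype.card T.Face

/-- The surface has genus `g`. -/
def HasGenus (g : ℕ) : Prop := (T.N₀ : ℤ) - T.N₁ + T.N₂ = 2 - 2 * g

open Classical in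
/-- The darts that issue from the vertex `k`; they correspond to the sides of the polygon dual
to `k`. -/
def dartsAt (k : T.Vertex) : Finset T.Dart := Finset.univ.filter fun d => T.vertex d = k

/-- The curvature assignment `q(k)`: the number of triangles (counted by their corners) at `k`,
which is the number of sides of the polygon dual to `k`. -/
def q (k : T.Vertex) : ℕ := (T.dartsAt k).card

/-! ### Automorphisms -/

/-- The group `Aut_∂(P)`: automorphisms of the (edge-refined) dual ribbon graph that preserve every
boundary component. -/
def autBdry : Subgroup (Equiv.Perm T.Dart) where
  carrier := {f | (∀ d, f (T.rot d) = T.rot (f d)) ∧ (∀ d, f (T.flip d) = T.flip (f d)) ∧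
    ∀ d, T.vertex (f d) = T.vertex d}
  mul_mem' := by
    rintro f g ⟨h1, h2, h3⟩ ⟨h4, h5, h6⟩
    refine ⟨fun d => ?_, fun d => ?_, fun d => ?_⟩ <;> simp [h1, h2, h3, h4, h5, h6]
  one_mem' := by simp
  inv_mem' := by
    rintro f ⟨h1, h2, h3⟩
    refine ⟨fun d => ?_, fun d => ?_, fun d => ?_⟩
    · apply f.injective; simp [h1]
    · apply f.injective; simp [h2]
    · simpa using (h3 (f⁻¹ d)).symm

/-- The permutation of the edges induced by an automorphism. -/
def edgeMap (f : T.autBdry) : T.Edge → T.Edge :=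
  Quotient.map f.1 (by
    rintro d _ ⟨n, rfl⟩
    refine ⟨n, ?_⟩
    have h : Commute f.1 T.flip := Equiv.ext fun d => f.2.2.1 d
    exact (congrArg (fun p : Equiv.Perm T.Dart => p d) (h.zpow_right n).eq).symm)

/-- Automorphisms act on half-edge lengths by permuting the half-edges. -/
instance dartAction : MulAction T.autBdry (T.Dart → ℝ) where
  smul f h := fun d => h ((f⁻¹).1 d)
  one_smul h := by funext d; change h _ = _; simp
  mul_smul f g h := by funext d; change h _ = h _; simp

/-- Automorphisms act on edge lengths by permuting the edges. -/
instance edgeAction : MulAction T.autBdry (T.Edge → ℝ) where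
  smul f l := fun e => l (T.edgeMap f⁻¹ e)
  one_smul l := by
    funext e; induction e using Quotient.inductionOn; change l _ = l _; simp [edgeMap]
  mul_smul f g l := by
    funext e; induction e using Quotient.inductionOn; change l _ = l _; simp [edgeMap]

/-! ### Regge triangulations and their dual polytopes -/

/-- Edge lengths of a Regge triangulation: every face is realized by a nondegenerate Euclidean
triangle. -/
def IsRegge (l : T.Edge → ℝ) : Prop :=
  ∀ d, 0 < l (T.edge d) ∧
    l (T.edge d) < l (T.edge (T.rot d)) + l (T.edge (T.rot (T.rot d)))

/-- The edge lengths of the dynamical (equilateral) triangulation of side `a`. -/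
def equilateral (a : ℝ) : T.Edge → ℝ := fun _ => a

/-- In a Euclidean triangle with sides `x`, `y`, `z`: the distance from the barycenter to the
midpoint of the side `x`. -/
def halfEdgeLength (x y z : ℝ) : ℝ := √(2 * y ^ 2 + 2 * z ^ 2 - x ^ 2) / 6

theorem dist_barycenter_midpoint {E : Type*} [NormedAddCommGroup E] [InnerProductSpace ℝ E]
    (A B C : E) :
    dist ((1 / 3 : ℝ) • (A + B + C)) ((1 / 2 : ℝ) • (A + B)) =
      halfEdgeLength (dist A B) (dist B C) (dist C A) := by
  have key : (6 * dist ((1 / 3 : ℝ) • (A + B + C)) ((1 / 2 : ℝ) • (A + B))) ^ 2 =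
      2 * dist B C ^ 2 + 2 * dist C A ^ 2 - dist A B ^ 2 := by
    have e : (1 / 3 : ℝ) • (A + B + C) - (1 / 2 : ℝ) • (A + B) =
        (1 / 6 : ℝ) • ((C - A) - (B - C)) := by module
    have e2 : A - B = -((C - A) + (B - C)) := by module
    have p := parallelogram_law_with_norm ℝ (C - A) (B - C)
    rw [dist_eq_norm, dist_eq_norm, dist_eq_norm, dist_eq_norm, e, norm_smul, e2, norm_neg]
    rw [Real.norm_of_nonneg (by norm_num : (0 : ℝ) ≤ 1 / 6)]
    nlinarith
  unfold halfEdgeLength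
  rw [← key, Real.sqrt_sq (by positivity)]
  ring

/-- The map `𝔓`: the half-edge lengths of the polytope barycentrically dual to a Regge
triangulation. -/
def dualPolytope (l : T.Edge → ℝ) : T.Dart → ℝ := fun d =>
  halfEdgeLength (l (T.edge d)) (l (T.edge (T.rot d))) (l (T.edge (T.rot (T.rot d))))

/-- The length of the side dual to the dart `d` of the polygon dual to the tail of `d`, as a linear
function of the half-edge lengths. -/
def side (d : T.Dart) : (T.Dart → ℝ) →L[ℝ] ℝ :=
  ContinuousLinearMap.proj (R := ℝ) (φ := fun _ : T.Dart => ℝ) d +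
    ContinuousLinearMap.proj (R := ℝ) (φ := fun _ : T.Dart => ℝ) (T.flip d)

/-- Half-edge lengths of a Regge polytope, i.e. of the dual of some Regge triangulation. -/
def IsReggePolytope (h : T.Dart → ℝ) : Prop := ∃ l, T.IsRegge l ∧ T.dualPolytope l = h

/-- The isoperimetric constraints: for every vertex `k` the side lengths of the polygon dual to `k`
are side lengths of a Euclidean polygon (each is positive and at most half the perimeter), whose
perimeter is that of the equilateral polygon with `q(k)` sides of length `(√3/3) a`. -/
def IsIsoperimetric (a : ℝ) (h : T.Dart → ℝ) : Prop :=
  ∀ k, (∑ d ∈ T.dartsAt k, T.side d h = (√3 / 3 * a) * T.q k) ∧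
    ∀ d ∈ T.dartsAt k, 0 < T.side d h ∧ T.side d h ≤ (√3 / 6 * a) * T.q k

open Classical in
/-- The isoperimetric deformations of the equilateral polytope of side `(√3/3) a`, in which exactly
`δ k` sides of the polygon dual to `k` are varied. -/
def polytopeDeformationsOfType (a : ℝ) (δ : T.Vertex → ℕ) : Set (T.Dart → ℝ) :=
  {h | T.IsReggePolytope h ∧ T.IsIsoperimetric a h ∧
    ∀ k, ((T.dartsAt k).filter fun d => T.side d h ≠ √3 / 3 * a).card = δ k}

/-- All isoperimetric deformations of the equilateral polytope. -/
def polytopeDeformations (a : ℝ) : Set (T.Dart → ℝ) :=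
  ⋃ δ : T.Vertex → ℕ, T.polytopeDeformationsOfType a δ

/-- The Regge triangulations obtained by isoperimetric deformations of the polytope dual to the
dynamical triangulation. -/
def reggeDeformations (a : ℝ) : Set (T.Edge → ℝ) :=
  {l | T.IsRegge l ∧ T.IsIsoperimetric a (T.dualPolytope l)}

/-- The map `𝔓` between the two sets of deformations. -/
def dualDeformation (a : ℝ) (l : T.reggeDeformations a) : T.polytopeDeformations a :=
  ⟨T.dualPolytope l.1, Set.mem_iUnion.2 ⟨_, ⟨l.1, l.2.1, rfl⟩, l.2.2, fun _ => rfl⟩⟩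

end TriangulatedSurface

/-! ### Quotients and orbifolds -/

/-- Points of `S` are identified when they lie in one `G`-orbit. -/
def orbitSetoid (G : Type*) {E : Type*} [Group G] [MulAction G E] (S : Set E) : Setoid S :=
  (MulAction.orbitRel G E).comap Subtype.val

/-- The quotient of `S` by `G`, with the quotient topology. -/
abbrev OrbitSpace (G : Type*) {E : Type*} [Group G] [MulAction G E] (S : Set E) : Type _ :=
  Quotient (orbitSetoid G S)

namespace TriangulatedSurface

variable (T : TriangulatedSurface.{u})

/-- The polytopal deformation space: isoperimetric deformations up to `Aut_∂(P)`. -/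
abbrev PolytopeSpace (a : ℝ) : Type u := OrbitSpace T.autBdry (T.polytopeDeformations a)

/-- The space of Regge triangulations obtained by isoperimetric deformations, up to `Aut_∂(P)`. -/
abbrev ReggeSpace (a : ℝ) : Type u := OrbitSpace T.autBdry (T.reggeDeformations a)

end TriangulatedSurface

/-- The open orthant `ℝ₊ᵈ`. -/
def posOrthant (d : ℕ) : Set (Fin d → ℝ) := {x | ∀ i, 0 < x i}

/-- `act` restricts to an action of `G` on `ℝ₊ᵈ` by diffeomorphisms. -/
structure IsSmoothAction {G : Type*} [Group G] {d : ℕ} (act : G → (Fin d → ℝ) → (Fin d → ℝ)) :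
    Prop where
  mapsTo : ∀ g, Set.MapsTo (act g) (posOrthant d) (posOrthant d)
  smooth : ∀ g, ContDiffOn ℝ ∞ (act g) (posOrthant d)
  one : ∀ x ∈ posOrthant d, act 1 x = x
  mul : ∀ g h, ∀ x ∈ posOrthant d, act (g * h) x = act g (act h x)

/-- `φ` is a `G`-equivariant diffeomorphism from `ℝ₊ᵈ` onto `S`, which is thus a `d`-dimensional
embedded submanifold of `E`; so it identifies the orbifolds `ℝ₊ᵈ / G` and `S / G`. -/
structure IsOrbifoldChart {G E : Type*} [Group G] [NormedAddCommGroup E] [NormedSpace ℝ E]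
    [MulAction G E] (S : Set E) {d : ℕ} (act : G → (Fin d → ℝ) → (Fin d → ℝ))
    (φ : (Fin d → ℝ) → E) : Prop where
  isSmoothAction : IsSmoothAction act
  smooth : ContDiffOn ℝ ∞ φ (posOrthant d)
  immersion : ∀ x ∈ posOrthant d, Function.Injective (fderiv ℝ φ x)
  isEmbedding : Topology.IsEmbedding ((posOrthant d).domRestrict φ)
  image_eq : φ '' posOrthant d = S
  equivariant : ∀ g, ∀ x ∈ posOrthant d, φ (act g x) = g • φ x

/-! ### Forms -/

/-- The wedge product of two covectors: `(f ∧ g)(v, w) = f v * g w - f w * g v`. -/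
def wedge {E : Type*} [NormedAddCommGroup E] [NormedSpace ℝ E] (f g : E →L[ℝ] ℝ) :
    E [⋀^Fin 2]→L[ℝ] ℝ :=
  ContinuousAlternatingMap.alternatizeUncurryFin
    (f.smulRight (ContinuousAlternatingMap.ofSubsingleton ℝ E ℝ (0 : Fin 1) g))

theorem wedge_apply {E : Type*} [NormedAddCommGroup E] [NormedSpace ℝ E] (f g : E →L[ℝ] ℝ)
    (v : Fin 2 → E) : wedge f g v = f (v 0) * g (v 1) - f (v 1) * g (v 0) := by
  simp [wedge, ContinuousAlternatingMap.alternatizeUncurryFin_apply, Fin.sum_univ_two,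
    Fin.removeNth, sub_eq_add_neg]

/-- The pullback of a differential 2-form. -/
def pullbackForm {E F : Type*} [NormedAddCommGroup E] [NormedSpace ℝ E] [NormedAddCommGroup F]
    [NormedSpace ℝ F] (φ : F → E) (θ : E → E [⋀^Fin 2]→L[ℝ] ℝ) : F → F [⋀^Fin 2]→L[ℝ] ℝ :=
  fun x => (θ (φ x)).compContinuousLinearMap (fderiv ℝ φ x)

/-- `η` is a (smooth) closed differential 2-form on the orbifold `ℝ₊ᵈ / G`. -/
structure IsClosedOrbifoldForm {G : Type*} {d : ℕ} (act : G → (Fin d → ℝ) → (Fin d → ℝ))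
    (η : (Fin d → ℝ) → (Fin d → ℝ) [⋀^Fin 2]→L[ℝ] ℝ) : Prop where
  smooth : ContDiffOn ℝ ∞ η (posOrthant d)
  invariant : ∀ g, Set.EqOn (pullbackForm (act g) η) η (posOrthant d)
  closed : ∀ x ∈ posOrthant d, extDeriv η x = 0

namespace TriangulatedSurface

variable (T : TriangulatedSurface.{u})

/-- The side lengths `L_α`, `α = 0, …, q(k) - 1`, in counterclockwise order, of the polygon dual to
the tail `k` of `d₀`, starting with the side dual to `d₀`. -/
def sideAt (d₀ : T.Dart) (α : ℕ) : (T.Dart → ℝ) →L[ℝ] ℝ := T.side ((T.next ^ α) d₀)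

/-- The connection 1-form
`ψ(k) = -[(√3/3) a q(k)]⁻² ∑_{α ≤ q(k) - 1} L_α (∑_{β ≤ α} dL_β)`,
with the sides numbered from the dart `d₀` at `k` (counting starts from `0` here). -/
def psi (a : ℝ) (d₀ : T.Dart) (h : T.Dart → ℝ) : (T.Dart → ℝ) [⋀^Fin 1]→L[ℝ] ℝ :=
  -((√3 / 3 * a * T.q (T.vertex d₀)) ^ 2)⁻¹ •
    ∑ α ∈ Finset.range (T.q (T.vertex d₀) - 1), ∑ β ∈ Finset.range (α + 1),
      T.sideAt d₀ α h • ContinuousAlternatingMap.ofSubsingleton ℝ (T.Dart → ℝ) ℝ (0 : Fin 1)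
        (T.sideAt d₀ β)

/-- The curvature 2-form
`ϖ(k) = [(√3/3) a q(k)]⁻² ∑_{1 ≤ α ≤ β ≤ q(k) - 1} dL_α ∧ dL_β`,
with the sides numbered from the dart `d₀` at `k` (counting starts from `0` here). -/
def varpi (a : ℝ) (d₀ : T.Dart) : (T.Dart → ℝ) [⋀^Fin 2]→L[ℝ] ℝ :=
  ((√3 / 3 * a * T.q (T.vertex d₀)) ^ 2)⁻¹ •
    ∑ β ∈ Finset.range (T.q (T.vertex d₀) - 1), ∑ α ∈ Finset.range (β + 1),
      wedge (T.sideAt d₀ α) (T.sideAt d₀ β)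

/-- `ϖ(k) = dψ(k)`. -/
theorem extDeriv_psi (a : ℝ) (d₀ : T.Dart) (h : T.Dart → ℝ) :
    extDeriv (T.psi a d₀) h = T.varpi a d₀ := by
  let c : ℝ := -((√3 / 3 * a * T.q (T.vertex d₀)) ^ 2)⁻¹
  let D : (T.Dart → ℝ) →L[ℝ] (T.Dart → ℝ) [⋀^Fin 1]→L[ℝ] ℝ :=
    c • ∑ α ∈ Finset.range (T.q (T.vertex d₀) - 1), ∑ β ∈ Finset.range (α + 1),
      (T.sideAt d₀ α).smulRight (ContinuousAlternatingMap.ofSubsingleton ℝ (T.Dart → ℝ) ℝ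
        (0 : Fin 1) (T.sideAt d₀ β))
  have hD : T.psi a d₀ = D := by
    funext x
    simp [psi, D, c, sum_apply]
  ext v
  rw [extDeriv, hD, D.fderiv]
  rw [ContinuousAlternatingMap.alternatizeUncurryFin_apply, Fin.sum_univ_two]
  simp only [varpi,
    ContinuousAlternatingMap.smul_apply, ContinuousAlternatingMap.sum_apply, wedge_apply, D,
    smul_apply, sum_apply, ContinuousLinearMap.smulRight_apply, Finset.smul_sum]
  simp only [← Finset.sum_add_distrib]
  refine Finset.sum_congr rfl fun α _ => Finset.sum_congr rfl fun β _ => ?_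
  have hv : Fin.tail v 0 = v 1 := rfl
  simp [Fin.removeNth, c, hv]
  ring

/-- The 2-form `Ω = ∑_k [(√3/3) a q(k)]² ϖ(k)`, where the sides of the polygon dual to `k` are
numbered from the dart `s k`. -/
def Omega (a : ℝ) (s : T.Vertex → T.Dart) : (T.Dart → ℝ) [⋀^Fin 2]→L[ℝ] ℝ :=
  ∑ k, (√3 / 3 * a * T.q k) ^ 2 • T.varpi a (s k)

end TriangulatedSurface

end

/-! The half-edges of the dual in one triangle are thirds of its medians, and the squares of the
medians determine the squares of the sides linearly. Hence `dualPolytope` has the explicit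
continuous equivariant left inverse `primalLengths`, smooth near the image of each Regge
triangulation; this gives the homeomorphism, and it carries charts from triangulations to polytopes.
The dimension comes from `2 * N₁ = 3 * N₂`, both being the number of darts, and Euler's formula.

Near `l ≡ a` the inequalities of the isoperimetric condition are strict because `q k ≥ 3`, so the
deformations are a level set of the `N₀` perimeters (`eventually_mem_reggeDeformations_iff`). The
perimeters form a submersion there (`surjective_fderiv_perimeter`): a vertex weight `lam` in the
cokernel satisfies, for every edge, (sum over its endpoints) + 2 (sum over the opposite vertices) =
0. Around a vertex `k` this is a cyclic convolution with stencil `(2, 1, 2)` of the neighbouring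
values. Its determinant is odd, so every neighbour has the value `-lam k / 5`; applying this twice
along an edge gives `lam k = lam k / 25`, so `lam = 0`.

An invariant submersion is straightened equivariantly by averaging a right inverse of its
differential over the finite group. The level set then becomes an invariant Euclidean ball in the
kernel, which is diffeomorphic to a vector space radially and then to the orthant by `exp`
(`exists_chart`).

`Omega` has constant coefficients, so its pullbacks are closed. Tangent vectors preserve every
perimeter, so cyclic renumbering of the sides of a polygon does not change `varpi` on them
(`sum_cross_shift`). An automorphism that fixes the boundary components only renumbers cyclically,
whence the invariance. -/

noncomputable section

/-! ### Cycles of permutations -/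

section Cycles

variable {α : Type*} [Fintype α]

open Classical in
theorem Equiv.Perm.isCycleOn_fiber (σ : Equiv.Perm α)
    (k : Quotient (Equiv.Perm.SameCycle.setoid σ)) :
    σ.IsCycleOn ((Finset.univ.filter fun d : α =>
      (Quotient.mk (Equiv.Perm.SameCycle.setoid σ) d) = k : Finset α) : Set α) := by
  constructor
  · refine ⟨fun d hd => ?_, σ.injective.injOn, fun d hd => ?_⟩
    · simp only [Finset.coe_filter, Finset.mem_univ, true_and, Set.mem_ofPred_eq] at hd ⊢
      rw [← hd]
      exact Quotient.sound (Equiv.Perm.sameCycle_apply_left.2 (Equiv.Perm.SameCycle.refl _ _))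
    · simp only [Finset.coe_filter, Finset.mem_univ, true_and, Set.mem_ofPred_eq] at hd
      refine ⟨σ⁻¹ d, ?_, by simp⟩
      simp only [Finset.coe_filter, Finset.mem_univ, true_and, Set.mem_ofPred_eq]
      rw [← hd]
      exact Quotient.sound ⟨1, by simp⟩
  · intro d hd e he
    simp only [Finset.coe_filter, Finset.mem_univ, true_and, Set.mem_ofPred_eq] at hd he
    exact Quotient.exact (hd.trans he.symm)

/-- Each cycle length divides the prime `p` and is not 1, so all cycles have length `p`. -/
theorem Equiv.Perm.prime_mul_card_quotient (σ : Equiv.Perm α) {p : ℕ} (hp : p.Prime)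
    (hσ : ∀ d, (σ ^ p) d = d) (hfix : ∀ d, σ d ≠ d)
    [Fintype (Quotient (Equiv.Perm.SameCycle.setoid σ))] :
    p * Fintype.card (Quotient (Equiv.Perm.SameCycle.setoid σ)) = Fintype.card α := by
  classical
  have h := Finset.card_eq_sum_card_fiberwise (s := (Finset.univ : Finset α))
    (t := (Finset.univ : Finset (Quotient (Equiv.Perm.SameCycle.setoid σ))))
    (f := fun d => Quotient.mk (Equiv.Perm.SameCycle.setoid σ) d) (by simp [Set.MapsTo])
  rw [← Finset.card_univ (α := α), h, mul_comm, ← smul_eq_mul, ← Finset.card_univ,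
    ← Finset.sum_const]
  refine Finset.sum_congr rfl fun k _ => ?_
  have hc := σ.isCycleOn_fiber k
  obtain ⟨d, rfl⟩ := Quotient.exists_rep k
  have hd : d ∈ Finset.univ.filter fun e : α =>
      (Quotient.mk (Equiv.Perm.SameCycle.setoid σ) e) =
        Quotient.mk (Equiv.Perm.SameCycle.setoid σ) d := by simp
  have h1 := (hc.pow_apply_eq hd (n := p)).1 (hσ d)
  rcases (Nat.dvd_prime hp).1 h1 with h2 | h2
  · exact absurd ((hc.pow_apply_eq hd (n := 1)).2 (by rw [h2])) (by simpa using hfix d)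
  · exact h2.symm

/-- The cyclic convolution operator with stencil `(2, 1, 2)` is injective, since its determinant is
odd. -/
theorem Equiv.Perm.eq_zero_of_stencil (σ : Equiv.Perm α) (y : α → ℝ)
    (h : ∀ d, y d + 2 * y (σ d) + 2 * y (σ⁻¹ d) = 0) : y = 0 := by
  classical
  let B : Matrix α α ℤ := 1 + 2 • (σ.permMatrix ℤ + (σ⁻¹).permMatrix ℤ)
  have hdet : B.det ≠ 0 := by
    intro h0
    have h1 : (Int.castRingHom (ZMod 2)) B.det = 0 := by rw [h0]; simp
    rw [RingHom.map_det] at h1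
    -- Modulo 2 the neighbour terms, which carry the coefficient 2, disappear.
    have h2 : (Int.castRingHom (ZMod 2)).mapMatrix B = 1 := by
      simp only [B, map_add, map_nsmul, map_one]
      rw [add_eq_left]
      ext i j
      simp only [Matrix.smul_apply, Matrix.zero_apply]
      exact CharTwo.two_nsmul _
    rw [h2, Matrix.det_one] at h1
    exact one_ne_zero h1
  have hdet' : ((Int.castRingHom ℝ).mapMatrix B).det ≠ 0 := by
    rw [← RingHom.map_det]
    simpa using hdet
  refine Matrix.eq_zero_of_mulVec_eq_zero hdet' ?_
  have hB : (Int.castRingHom ℝ).mapMatrix B =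
      1 + (2 : ℝ) • (σ.permMatrix ℝ + (σ⁻¹).permMatrix ℝ) := by
    ext i j
    simp only [B, RingHom.mapMatrix_apply, Matrix.map_apply, Matrix.add_apply, Matrix.smul_apply,
      Equiv.Perm.permMatrix, PEquiv.toMatrix_apply, Matrix.one_apply]
    simp only [nsmul_eq_mul, smul_eq_mul, map_add, map_mul, apply_ite (Int.castRingHom ℝ), map_one,
      map_zero]
    simp
  rw [hB]
  funext d
  have := h d
  simp only [Matrix.add_mulVec, Matrix.smul_mulVec, Matrix.one_mulVec, Pi.add_apply,
    Pi.smul_apply, smul_eq_mul, Matrix.permMatrix_mulVec, Function.comp_apply, Pi.zero_apply]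
  linarith

end Cycles

/-! ### Counting darts and cells -/

namespace TriangulatedSurface

variable (T : TriangulatedSurface.{u})

theorem two_mul_N₁ : 2 * T.N₁ = Fintype.card T.Dart :=
  letI : Fintype (Quotient (Equiv.Perm.SameCycle.setoid T.flip)) :=
    inferInstanceAs (Fintype T.Edge)
  T.flip.prime_mul_card_quotient Nat.prime_two
    (fun d => by simp [sq, T.flip_flip]) T.flip_ne

theorem three_mul_N₂ : 3 * T.N₂ = Fintype.card T.Dart :=
  letI : Fintype (Quotient (Equiv.Perm.SameCycle.setoid T.rot)) :=
    inferInstanceAs (Fintype T.Face)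
  T.rot.prime_mul_card_quotient Nat.prime_three
    (fun d => by simp [pow_succ, T.rot_rot_rot]) T.rot_ne

theorem sum_q : ∑ k, T.q k = Fintype.card T.Dart := by
  classical
  have h := Finset.card_eq_sum_card_fiberwise (s := (Finset.univ : Finset T.Dart))
    (t := (Finset.univ : Finset T.Vertex)) (f := T.vertex) (by simp [Set.MapsTo])
  rw [← Finset.card_univ (α := T.Dart), h]
  refine Finset.sum_congr rfl fun k _ => ?_
  unfold q dartsAt
  congr!

/-- `3 * N₀ ≤ ∑ q = 2 * N₁`. This makes the natural number `N₁ - N₀` a genuine difference. -/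
theorem N₀_le_N₁ (hq : ∀ k, 3 ≤ T.q k) : T.N₀ ≤ T.N₁ := by
  have h : T.N₀ * 3 ≤ ∑ k, T.q k := by
    rw [N₀, ← Finset.card_univ, ← smul_eq_mul]
    exact Finset.card_nsmul_le_sum _ _ _ fun k _ => hq k
  have h1 := T.sum_q
  have h2 := T.two_mul_N₁
  omega

theorem N₁_sub_N₀ {g : ℕ} (hg : T.HasGenus g) (hq : ∀ k, 3 ≤ T.q k) :
    ((T.N₁ - T.N₀ : ℕ) : ℤ) = 2 * T.N₀ + 6 * g - 6 := by
  have h0 := T.N₀_le_N₁ hq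
  have h1 := T.two_mul_N₁
  have h2 := T.three_mul_N₂
  unfold HasGenus at hg
  omega

/-! ### Incidences -/

theorem mem_dartsAt {d : T.Dart} {k : T.Vertex} : d ∈ T.dartsAt k ↔ T.vertex d = k := by
  simp [dartsAt]

theorem isCycleOn_dartsAt (k : T.Vertex) : T.next.IsCycleOn (T.dartsAt k : Set T.Dart) := by
  convert T.next.isCycleOn_fiber k using 2
  ext d
  simp only [mem_dartsAt, Finset.mem_filter, Finset.mem_univ, true_and]
  rfl

theorem vertex_next (d : T.Dart) : T.vertex (T.next d) = T.vertex d :=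
  Quotient.sound (Equiv.Perm.sameCycle_apply_left.2 (Equiv.Perm.SameCycle.refl _ _))

theorem vertex_rot (d : T.Dart) : T.vertex (T.rot d) = T.vertex (T.flip d) := by
  rw [← T.vertex_next (T.rot d)]
  simp [next]

theorem edge_flip (d : T.Dart) : T.edge (T.flip d) = T.edge d :=
  Quotient.sound (Equiv.Perm.sameCycle_apply_left.2 (Equiv.Perm.SameCycle.refl _ _))

theorem rot_inv (d : T.Dart) : T.rot⁻¹ d = T.rot (T.rot d) := by
  rw [Equiv.Perm.inv_eq_iff_eq, T.rot_rot_rot]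

theorem flip_inv (d : T.Dart) : T.flip⁻¹ d = T.flip d := by
  rw [Equiv.Perm.inv_eq_iff_eq, T.flip_flip]

theorem exists_edge_eq (e : T.Edge) : ∃ d, T.edge d = e := Quotient.exists_rep e

theorem edge_eq_iff {d e : T.Dart} : T.edge d = T.edge e ↔ e = d ∨ e = T.flip d := by
  constructor
  · intro h
    obtain ⟨n, hn⟩ : T.flip.SameCycle d e := Quotient.exact h
    have h2 : T.flip ^ (2 : ℤ) = 1 := Equiv.ext fun x => by
      simp [zpow_ofNat, sq, T.flip_flip]
    rcases Int.even_or_odd' n with ⟨m, rfl | rfl⟩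
    · left; rw [← hn, zpow_mul, h2]; simp
    · right; rw [← hn, zpow_add, zpow_mul, h2]; simp
  · rintro (rfl | rfl)
    · rfl
    · exact (T.edge_flip d).symm

/-- A function on darts that is invariant under `flip` descends to edges. -/
def edgeLift (c : T.Dart → ℝ) (hc : ∀ d, c (T.flip d) = c d) : T.Edge → ℝ :=
  Quotient.lift c fun d e h => by
    rcases (T.edge_eq_iff (d := d) (e := e)).1 (Quotient.sound h) with rfl | rfl
    · rfl
    · exact (hc d).symm

@[simp] theorem edgeLift_edge (c : T.Dart → ℝ) (hc : ∀ d, c (T.flip d) = c d) (d : T.Dart) :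
    T.edgeLift c hc (T.edge d) = c d := rfl

/-- The vertex weights `lam` for which the sum of `lam` over the two endpoints of an edge and twice
the sum over the two opposite vertices cancel, vanish. -/
theorem vertexWeight_eq_zero (lam : T.Vertex → ℝ)
    (h : ∀ d, lam (T.vertex d) + lam (T.vertex (T.flip d)) +
      2 * lam (T.vertex (T.flip (T.next d))) + 2 * lam (T.vertex (T.flip (T.next⁻¹ d))) = 0) :
    lam = 0 := by
  have hinv : ∀ d, T.vertex (T.next⁻¹ d) = T.vertex d := fun d => by
    rw [← T.vertex_next (T.next⁻¹ d)]; simp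
  -- The weight at the centre is constant along the cycle; since 2 + 1 + 2 = 5, adding a fifth of it
  -- makes the equation homogeneous.
  have key := T.next.eq_zero_of_stencil
    (fun d => lam (T.vertex (T.flip d)) + lam (T.vertex d) / 5) (fun d => by
      rw [T.vertex_next, hinv]; linarith [h d])
  have key' : ∀ d, lam (T.vertex (T.flip d)) + lam (T.vertex d) / 5 = 0 := fun d => congrFun key d
  funext k
  obtain ⟨d, rfl⟩ := Quotient.exists_rep k
  have h1 := key' d
  -- The same relation seen from the other end of the edge; together they give `lam = lam / 25`.
  have h2 := key' (T.flip d)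
  rw [T.flip_flip] at h2
  change lam (T.vertex d) = 0
  linarith

/-- The differential of the perimeters at an equilateral triangulation has no cokernel. -/
theorem vertexWeight_eq_zero_of_orthogonal (lam : T.Vertex → ℝ)
    (h : ∀ u : T.Edge → ℝ, ∑ d, (lam (T.vertex d) + lam (T.vertex (T.flip d))) *
      (2 * u (T.edge (T.rot d)) + 2 * u (T.edge (T.rot (T.rot d))) - u (T.edge d)) = 0) :
    lam = 0 := by
  let w : T.Dart → ℝ := fun d => lam (T.vertex d) + lam (T.vertex (T.flip d))
  -- The transposed operator applied to `w`: reindexing by `rot` moves the stencil from `u` to `w`.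
  let c : T.Dart → ℝ := fun d => 2 * w (T.rot d) + 2 * w (T.rot (T.rot d)) - w d
  have hc : ∀ u : T.Edge → ℝ, ∑ d, c d * u (T.edge d) = 0 := by
    intro u
    rw [← h u]
    have e1 : ∑ d, w (T.rot d) * u (T.edge d) = ∑ d, w d * u (T.edge (T.rot (T.rot d))) := by
      rw [← Equiv.sum_comp T.rot fun d => w d * u (T.edge (T.rot (T.rot d)))]
      simp [T.rot_rot_rot]
    have e2 : ∑ d, w (T.rot (T.rot d)) * u (T.edge d) = ∑ d, w d * u (T.edge (T.rot d)) := by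
      rw [← Equiv.sum_comp T.rot fun d => w (T.rot (T.rot d)) * u (T.edge d)]
      simp [T.rot_rot_rot]
    calc ∑ d, c d * u (T.edge d) = 2 * ∑ d, w (T.rot d) * u (T.edge d) +
          2 * ∑ d, w (T.rot (T.rot d)) * u (T.edge d) - ∑ d, w d * u (T.edge d) := by
          simp only [Finset.mul_sum, ← Finset.sum_add_distrib, ← Finset.sum_sub_distrib]
          exact Finset.sum_congr rfl fun d _ => by simp only [c]; ring
      _ = _ := by
          rw [e1, e2]
          simp only [Finset.mul_sum, ← Finset.sum_add_distrib, ← Finset.sum_sub_distrib]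
          exact Finset.sum_congr rfl fun d _ => by simp only [w]; ring
  let b : T.Dart → ℝ := fun d => c d + c (T.flip d)
  have hb : ∀ d, b (T.flip d) = b d := fun d => by simp only [b, T.flip_flip]; ring
  -- Only the `flip`-symmetric part `b` of `c` is seen by functions on edges. Testing against `b`
  -- itself makes `∑ b²` vanish.
  have h1 := hc (T.edgeLift b hb)
  have h2 : ∑ d, b d ^ 2 = 0 := by
    have e : ∑ d, c (T.flip d) * b d = ∑ d, c d * b d := by
      rw [← Equiv.sum_comp T.flip fun d => c d * b d]
      simp [hb]
    calc ∑ d, b d ^ 2 = ∑ d, c d * b d + ∑ d, c (T.flip d) * b d := by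
          rw [← Finset.sum_add_distrib]
          exact Finset.sum_congr rfl fun d _ => by simp only [b]; ring
      _ = 0 := by rw [e]; simpa using h1
  have h3 : ∀ d, b d = 0 := fun d => by
    have := (Finset.sum_eq_zero_iff_of_nonneg fun d _ => sq_nonneg (b d)).1 h2 d (Finset.mem_univ d)
    simpa using this
  refine T.vertexWeight_eq_zero lam fun d => ?_
  have h4 := h3 d
  have a1 : T.next d = T.flip (T.rot (T.rot d)) := by rw [next, Equiv.Perm.mul_apply, T.rot_inv]
  have a2 : T.next⁻¹ d = T.rot (T.flip d) := by
    rw [next, mul_inv_rev, inv_inv, Equiv.Perm.mul_apply, T.flip_inv]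
  have v1 : ∀ x, T.vertex (T.flip (T.rot x)) = T.vertex (T.rot (T.rot x)) := fun x =>
    (T.vertex_rot _).symm
  have v2 : ∀ x, T.vertex (T.flip (T.rot (T.rot x))) = T.vertex x := fun x => by
    rw [v1, T.rot_rot_rot]
  have v3 := T.vertex_rot d
  have v4 := T.vertex_rot (T.flip d)
  rw [T.flip_flip] at v4
  simp only [b, c, w, v2, v1, v3, v4, T.flip_flip] at h4
  rw [a1, a2, T.flip_flip, v1]
  linarith [congrArg lam (v1 (T.flip d)), congrArg lam (T.vertex_rot (T.rot d)),
    congrArg lam (v1 d)]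

end TriangulatedSurface

/-! ### Balls and linear spaces -/

section RadialMap

variable {ι : Type*} [Fintype ι]

/-- The squared Euclidean norm. -/
def sumSq (y : ι → ℝ) : ℝ := ∑ i, y i ^ 2

theorem sumSq_nonneg (y : ι → ℝ) : 0 ≤ sumSq y := Finset.sum_nonneg fun i _ => sq_nonneg (y i)

theorem sumSq_smul (c : ℝ) (y : ι → ℝ) : sumSq (c • y) = c ^ 2 * sumSq y := by
  simp [sumSq, mul_pow, Finset.mul_sum]

theorem contDiff_sumSq {n : WithTop ℕ∞} : ContDiff ℝ n (sumSq : (ι → ℝ) → ℝ) := by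
  unfold sumSq
  fun_prop

theorem norm_lt_of_sumSq_lt {y : ι → ℝ} {r : ℝ} (hr : 0 < r) (h : sumSq y < r ^ 2) : ‖y‖ < r := by
  rw [pi_norm_lt_iff hr]
  intro i
  rw [Real.norm_eq_abs]
  refine abs_lt_of_sq_lt_sq (lt_of_le_of_lt ?_ h) hr.le
  exact Finset.single_le_sum (f := fun i => y i ^ 2) (fun i _ => sq_nonneg _) (Finset.mem_univ i)

/-- The radial diffeomorphism from the whole space onto the Euclidean ball of radius `r`. -/
def toBall (r : ℝ) (y : ι → ℝ) : ι → ℝ := (r / √(1 + sumSq y)) • y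

/-- The inverse of `toBall`. -/
def ofBall (r : ℝ) (z : ι → ℝ) : ι → ℝ := (1 / √(r ^ 2 - sumSq z)) • z

theorem contDiff_toBall (r : ℝ) {n : WithTop ℕ∞} :
    ContDiff ℝ n (toBall r : (ι → ℝ) → ι → ℝ) := by
  have h : ∀ y : ι → ℝ, 0 < 1 + sumSq y := fun y => by linarith [sumSq_nonneg y]
  have h1 : ContDiff ℝ n fun y : ι → ℝ => 1 + sumSq y := contDiff_const.add contDiff_sumSq
  exact (contDiff_const.div (h1.sqrt fun y => (h y).ne')
    fun y => (Real.sqrt_pos.2 (h y)).ne').smul contDiff_id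

theorem contDiffAt_ofBall {r : ℝ} {z : ι → ℝ} (hz : sumSq z < r ^ 2) {n : WithTop ℕ∞} :
    ContDiffAt ℝ n (ofBall r) z := by
  have h : 0 < r ^ 2 - sumSq z := by linarith
  have h1 : ContDiffAt ℝ n (fun y : ι → ℝ => r ^ 2 - sumSq y) z :=
    contDiffAt_const.sub contDiff_sumSq.contDiffAt
  exact (contDiffAt_const.div (h1.sqrt h.ne') (Real.sqrt_pos.2 h).ne').smul contDiffAt_id

theorem sumSq_toBall_lt {r : ℝ} (hr : 0 < r) (y : ι → ℝ) : sumSq (toBall r y) < r ^ 2 := by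
  have h := sumSq_nonneg y
  rw [toBall, sumSq_smul, div_pow, Real.sq_sqrt (by linarith), div_mul_eq_mul_div,
    div_lt_iff₀ (by linarith)]
  nlinarith [pow_pos hr 2]

theorem ofBall_toBall {r : ℝ} (hr : 0 < r) (y : ι → ℝ) : ofBall r (toBall r y) = y := by
  have h := sumSq_nonneg y
  have e : r ^ 2 - sumSq (toBall r y) = (r / √(1 + sumSq y)) ^ 2 := by
    rw [toBall, sumSq_smul, div_pow, Real.sq_sqrt (by linarith)]
    field_simp
    ring
  have hpos : 0 < r / √(1 + sumSq y) := div_pos hr (Real.sqrt_pos.2 (by linarith))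
  rw [ofBall, e, Real.sqrt_sq hpos.le, toBall, smul_smul, one_div, inv_mul_cancel₀ hpos.ne',
    one_smul]

theorem toBall_ofBall {r : ℝ} (hr : 0 < r) {z : ι → ℝ} (hz : sumSq z < r ^ 2) :
    toBall r (ofBall r z) = z := by
  have h : 0 < r ^ 2 - sumSq z := by linarith
  have e : 1 + sumSq (ofBall r z) = (r / √(r ^ 2 - sumSq z)) ^ 2 := by
    rw [ofBall, sumSq_smul, div_pow, div_pow, Real.sq_sqrt h.le]
    field_simp
    ring
  have hs := Real.sqrt_pos.2 h
  rw [toBall, e, Real.sqrt_sq (div_pos hr hs).le, ofBall, smul_smul]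
  rw [show r / (r / √(r ^ 2 - sumSq z)) * (1 / √(r ^ 2 - sumSq z)) = 1 by field_simp, one_smul]

end RadialMap

theorem isOpen_posOrthant (d : ℕ) : IsOpen (posOrthant d) := by
  have : posOrthant d = Set.pi Set.univ fun _ => Set.Ioi 0 := by
    ext x; simp [posOrthant]
  rw [this]
  exact isOpen_set_pi Set.finite_univ fun _ _ => isOpen_Ioi

/-! ### Equivariant charts of level sets -/

section EquivariantChart

variable {ι κ G : Type*} [Fintype κ] [Group G] [MulAction G (ι → ℝ)]

/-- A group acts on functions by permutations of the arguments. -/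
def IsPermAction (G : Type*) {ι : Type*} [Group G] [MulAction G (ι → ℝ)] : Prop :=
  ∀ g : G, ∃ σ : Equiv.Perm ι, ∀ l : ι → ℝ, g • l = l ∘ σ

namespace IsPermAction

variable (hG : IsPermAction G (ι := ι))
include hG

theorem exists_linear (g : G) : ∃ L : (ι → ℝ) →L[ℝ] (ι → ℝ), ∀ l, g • l = L l := by
  obtain ⟨σ, hσ⟩ := hG g
  exact ⟨ContinuousLinearMap.pi fun i => ContinuousLinearMap.proj (σ i), fun l => by
    rw [hσ]; rfl⟩

theorem smul_sub (g : G) (l m : ι → ℝ) : g • (l - m) = g • l - g • m := by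
  obtain ⟨L, hL⟩ := hG.exists_linear g
  simp [hL]

theorem smul_add (g : G) (l m : ι → ℝ) : g • (l + m) = g • l + g • m := by
  obtain ⟨L, hL⟩ := hG.exists_linear g
  simp [hL]

/-- A surjection that is invariant under a finite group has a right inverse with values in the
fixed vectors. -/
theorem exists_rightInverse [Finite G] (D : (ι → ℝ) →L[ℝ] (κ → ℝ)) (hD : Function.Surjective D)
    (hinv : ∀ (g : G) l, D (g • l) = D l) :
    ∃ R : (κ → ℝ) →L[ℝ] (ι → ℝ), (∀ v, D (R v) = v) ∧ ∀ (g : G) v, g • R v = R v := by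
  have := Fintype.ofFinite G
  obtain ⟨R₀, hR₀⟩ := LinearMap.exists_rightInverse_of_surjective D.toLinearMap
    (LinearMap.range_eq_top.2 hD)
  have hR₀' : ∀ v, D (R₀ v) = v := fun v => congrArg (fun A : (κ → ℝ) →ₗ[ℝ] _ => A v) hR₀
  choose L hL using hG.exists_linear
  have hL' : ∀ g h v, L g (L h v) = L (g * h) v := fun g h v => by
    rw [← hL, ← hL, ← hL, mul_smul]
  -- The average over `G` of an arbitrary linear right inverse; invariance of `D` keeps it a right
  -- inverse.
  let R : (κ → ℝ) →L[ℝ] (ι → ℝ) :=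
    (Fintype.card G : ℝ)⁻¹ • ∑ g, (L g).comp (LinearMap.toContinuousLinearMap R₀)
  have hR : ∀ v, R v = (Fintype.card G : ℝ)⁻¹ • ∑ g, L g (R₀ v) := fun v => by
    simp [R, sum_apply]
  refine ⟨R, fun v => ?_, fun h v => ?_⟩
  · rw [hR, map_smul, map_sum]
    simp only [← hL, hinv, hR₀', Finset.sum_const, Finset.card_univ]
    rw [← Nat.cast_smul_eq_nsmul ℝ, smul_smul, inv_mul_cancel₀ (by simp), one_smul]
  · rw [hR, hL, map_smul, map_sum]
    simp only [hL']
    congr 1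
    exact Equiv.sum_comp (Equiv.mulLeft h) fun g => L g (R₀ v)

variable [Fintype ι]

theorem contDiff_smul {n : WithTop ℕ∞} (g : G) : ContDiff ℝ n fun l : ι → ℝ => g • l := by
  obtain ⟨L, hL⟩ := hG.exists_linear g
  rw [funext hL]
  exact L.contDiff

theorem sumSq_smul (g : G) (l : ι → ℝ) : sumSq (g • l) = sumSq l := by
  obtain ⟨σ, hσ⟩ := hG g
  rw [hσ]
  exact Equiv.sum_comp σ fun i => l i ^ 2

theorem norm_smul (g : G) (l : ι → ℝ) : ‖g • l‖ = ‖l‖ := by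
  obtain ⟨σ, hσ⟩ := hG g
  have key : ∀ (τ : Equiv.Perm ι) (l : ι → ℝ), ‖l ∘ τ‖ ≤ ‖l‖ := fun τ l =>
    (pi_norm_le_iff_of_nonneg (norm_nonneg l)).2 fun i => norm_le_pi_norm l (τ i)
  rw [hσ]
  refine le_antisymm (key σ l) ?_
  have := key σ⁻¹ (l ∘ σ)
  rwa [Function.comp_assoc, ← Equiv.Perm.coe_mul, mul_inv_cancel] at this

/-- An invariant submersion is straightened by an equivariant local diffeomorphism. -/
theorem exists_straightening [Finite G] {F : (ι → ℝ) → (κ → ℝ)} {e₀ : ι → ℝ}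
    (he₀ : ∀ g : G, g • e₀ = e₀) (hF : ContDiffAt ℝ ω F e₀) (hinv : ∀ (g : G) l, F (g • l) = F l)
    (hsurj : Function.Surjective (fderiv ℝ F e₀)) :
    ∃ Ψ : (ι → ℝ) → (ι → ℝ), Ψ e₀ = 0 ∧ ContDiffAt ℝ ω Ψ e₀ ∧
      HasFDerivAt Ψ (ContinuousLinearMap.id ℝ (ι → ℝ)) e₀ ∧
      (∀ (g : G) l, Ψ (g • l) = g • Ψ l) ∧
      ∀ l, fderiv ℝ F e₀ (Ψ l) = F l - F e₀ := by
  have hd : HasFDerivAt F (fderiv ℝ F e₀) e₀ := (hF.differentiableAt (by simp)).hasFDerivAt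
  set D := fderiv ℝ F e₀ with hDdef
  -- Differentiate `F ∘ g = F` at the fixed point `e₀`.
  have hDinv : ∀ (g : G) l, D (g • l) = D l := by
    intro g l
    obtain ⟨L, hL⟩ := hG.exists_linear g
    have h1 : HasFDerivAt (fun l => F (L l)) (D.comp L) e₀ := by
      refine HasFDerivAt.comp (g := F) e₀ ?_ L.hasFDerivAt
      rw [← hL, he₀]
      exact hd
    have h2 : (fun l => F (L l)) = F := funext fun l => by rw [← hL, hinv]
    rw [h2] at h1
    rw [hL, ← ContinuousLinearMap.comp_apply, h1.unique hd]
  obtain ⟨R, hR, hRG⟩ := hG.exists_rightInverse D hsurj hDinv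
  have hid : HasFDerivAt (fun l : ι → ℝ => l - e₀) (ContinuousLinearMap.id ℝ (ι → ℝ)) e₀ :=
    (hasFDerivAt_id e₀).sub_const e₀
  -- The correction by `R` replaces the linear part `D (l - e₀)` by the full increment `F l - F e₀`.
  -- It vanishes to first order at `e₀`, and its values are fixed by `G`.
  refine ⟨fun l => (l - e₀) + R (F l - F e₀ - D (l - e₀)), by simp, ?_, ?_, fun g l => ?_,
    fun l => ?_⟩
  · have h1 : ContDiffAt ℝ ω (fun l : ι → ℝ => l - e₀) e₀ := contDiffAt_id.sub contDiffAt_const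
    exact h1.add (R.contDiff.contDiffAt.comp e₀
      ((hF.sub contDiffAt_const).sub (D.contDiff.contDiffAt.comp e₀ h1)))
  · have h2 : HasFDerivAt (fun l => F l - F e₀ - D (l - e₀)) (D - D.comp (.id ℝ _)) e₀ :=
      (hd.sub_const _).sub (D.hasFDerivAt.comp e₀ hid)
    have h3 := hid.add (R.hasFDerivAt.comp e₀ h2)
    refine HasFDerivAt.congr_fderiv h3 ?_
    ext1 v
    simp
  · have e : g • l - e₀ = g • (l - e₀) := by rw [hG.smul_sub, he₀]
    simp only [e, hinv, hDinv, hG.smul_add, hRG]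
  · simp only [map_add, hR]
    abel

/-- Around a fixed point, a level set of an invariant submersion has arbitrarily small invariant
charts by the orthant. -/
theorem exists_chart [Finite G] {F : (ι → ℝ) → (κ → ℝ)} {e₀ : ι → ℝ}
    (he₀ : ∀ g : G, g • e₀ = e₀) (hF : ContDiffAt ℝ ω F e₀) (hinv : ∀ (g : G) l, F (g • l) = F l)
    (hsurj : Function.Surjective (fderiv ℝ F e₀)) {N : Set (ι → ℝ)} (hN : N ∈ 𝓝 e₀) {d : ℕ}
    (hd : Fintype.card κ + d = Fintype.card ι) :
    ∃ (W : Set (ι → ℝ)) (φ : (Fin d → ℝ) → (ι → ℝ)) (ψ : (ι → ℝ) → (Fin d → ℝ)),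
      W ⊆ N ∧ IsOpen W ∧ e₀ ∈ W ∧ (∀ g : G, ∀ l ∈ W, g • l ∈ W) ∧
      ContDiffOn ℝ ∞ φ (posOrthant d) ∧ ContDiffOn ℝ ∞ ψ W ∧ (∀ l, ψ l ∈ posOrthant d) ∧
      (∀ x ∈ posOrthant d, ψ (φ x) = x) ∧ φ '' posOrthant d = {l | l ∈ W ∧ F l = F e₀} := by
  obtain ⟨Ψ, hΨ0, hΨc, hΨd, hΨG, hΨF⟩ := hG.exists_straightening he₀ hF hinv hsurj
  set D := fderiv ℝ F e₀
  have hΨd' : HasFDerivAt Ψ (ContinuousLinearEquiv.refl ℝ (ι → ℝ) : (ι → ℝ) →L[ℝ] (ι → ℝ)) e₀ :=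
    hΨd
  let P := hΨc.toOpenPartialHomeomorph Ψ hΨd' (by simp)
  have hP : ∀ l, P l = Ψ l := fun l => rfl
  have hPs : e₀ ∈ P.source := hΨc.mem_toOpenPartialHomeomorph_source hΨd' (by simp)
  have hPt : (0 : ι → ℝ) ∈ P.target := by rw [← hΨ0, ← hP]; exact P.map_source hPs
  have hP0 : P.symm 0 = e₀ := by rw [← hΨ0, ← hP, P.left_inv hPs]
  have hPc : ContDiffAt ℝ ω P.symm 0 :=
    P.contDiffAt_symm hPt (f₀' := ContinuousLinearEquiv.refl ℝ (ι → ℝ))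
      (by rw [hP0]; exact hΨd') (by rw [hP0]; exact hΨc)
  -- Inside the ball of radius `ρ` the map `Ψ` is smooth and invertible, and the points lie in `N`;
  -- inside the ball of radius `r` below, the inverse is smooth and stays in the first ball.
  obtain ⟨ρ, hρ, hρb⟩ := Metric.eventually_nhds_iff_ball.1
    (((hΨc.eventually (by simp)).and hN).and (P.open_source.mem_nhds hPs))
  have hsymm : ∀ᶠ z in 𝓝 (0 : ι → ℝ), P.symm z ∈ Metric.ball e₀ ρ := by
    refine (P.continuousAt_symm hPt).eventually ?_
    rw [hP0]
    exact Metric.ball_mem_nhds e₀ hρ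
  obtain ⟨r, hr, hrb⟩ := Metric.eventually_nhds_iff_ball.1
    (((hPc.eventually (by simp)).and hsymm).and (P.open_target.mem_nhds hPt))
  have hO : ∀ {z : ι → ℝ}, sumSq z < r ^ 2 → z ∈ Metric.ball (0 : ι → ℝ) r := fun hz => by
    simpa using norm_lt_of_sumSq_lt hr hz
  -- The ball of `pi`-norm around `e₀` and the Euclidean ball around 0 are both permutation
  -- invariant. The second is Euclidean so that its radial diffeomorphism is smooth.
  let W : Set (ι → ℝ) := Metric.ball e₀ ρ ∩ Ψ ⁻¹' {z | sumSq z < r ^ 2}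
  obtain ⟨E⟩ : Nonempty ((Fin d → ℝ) ≃ₗ[ℝ] LinearMap.ker D.toLinearMap) := by
    refine ⟨LinearEquiv.ofFinrankEq _ _ ?_⟩
    have h1 := LinearMap.finrank_range_add_finrank_ker D.toLinearMap
    rw [LinearMap.range_eq_top.2 hsurj, finrank_top, Module.finrank_fintype_fun_eq_card,
      Module.finrank_fintype_fun_eq_card] at h1
    rw [Module.finrank_fin_fun]
    omega
  let J : (Fin d → ℝ) →L[ℝ] (ι → ℝ) :=
    LinearMap.toContinuousLinearMap ((LinearMap.ker D.toLinearMap).subtype ∘ₗ E.toLinearMap)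
  have hDJ : ∀ y, D (J y) = 0 := fun y => (E y).2
  have hJsurj : ∀ z, D z = 0 → ∃ y, J y = z := fun z hz =>
    ⟨E.symm ⟨z, hz⟩, by simp [J]⟩
  -- A left inverse of the parametrization `J` of the kernel, defined on the whole space, lets `ψ`
  -- be smooth on the open set `W` and not only on the level set.
  obtain ⟨K₀, hK₀⟩ := LinearMap.exists_leftInverse_of_injective J.toLinearMap
    (LinearMap.ker_eq_bot.2 (Subtype.val_injective.comp E.injective))
  let K : (ι → ℝ) →L[ℝ] (Fin d → ℝ) := LinearMap.toContinuousLinearMap K₀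
  have hKJ : ∀ y, K (J y) = y := fun y => congrArg (fun A : (Fin d → ℝ) →ₗ[ℝ] _ => A y) hK₀
  let φ : (Fin d → ℝ) → (ι → ℝ) := fun x => P.symm (toBall r (J fun i => Real.log (x i)))
  let ψ : (ι → ℝ) → (Fin d → ℝ) := fun l i => Real.exp (K (ofBall r (Ψ l)) i)
  have hΨφ : ∀ x, Ψ (φ x) = toBall r (J fun i => Real.log (x i)) := fun x =>
    P.right_inv (hrb _ (hO (sumSq_toBall_lt hr _))).2
  refine ⟨W, φ, ψ, fun l hl => (hρb l hl.1).1.2, ?_, ?_, ?_, ?_, ?_, ?_, ?_, ?_⟩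
  · refine ContinuousOn.isOpen_inter_preimage (fun l hl => ?_) Metric.isOpen_ball
      (isOpen_lt (contDiff_sumSq (n := 0)).continuous continuous_const)
    exact (hρb l hl).1.1.continuousAt.continuousWithinAt
  · refine ⟨Metric.mem_ball_self hρ, ?_⟩
    simp only [Set.mem_preimage, hΨ0]
    change sumSq (0 : ι → ℝ) < r ^ 2
    simp [sumSq, hr]
  · rintro g l ⟨h1, h2⟩
    refine ⟨?_, ?_⟩
    · rw [mem_ball_iff_norm] at h1 ⊢
      rwa [← he₀ g, ← hG.smul_sub, hG.norm_smul]
    · change sumSq (Ψ (g • l)) < r ^ 2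
      rw [hΨG, hG.sumSq_smul]
      exact h2
  · intro x hx
    refine ContDiffAt.contDiffWithinAt ?_
    refine ContDiffAt.comp (g := P.symm) x ((hrb _ (hO (sumSq_toBall_lt hr _))).1.1.of_le le_top) ?_
    refine (contDiff_toBall r).contDiffAt.comp x (J.contDiff.contDiffAt.comp x ?_)
    rw [contDiffAt_pi]
    exact fun i => (contDiff_apply ℝ ℝ i).contDiffAt.log (hx i).ne'
  · intro l hl
    refine ContDiffAt.contDiffWithinAt ?_
    rw [contDiffAt_pi]
    intro i
    refine ContDiffAt.exp ?_
    have h1 : ContDiffAt ℝ ∞ (fun l => K (ofBall r (Ψ l))) l :=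
      K.contDiff.contDiffAt.comp l ((contDiffAt_ofBall hl.2).comp l
        ((hρb l hl.1).1.1.of_le le_top))
    exact (contDiffAt_pi.1 h1) i
  · exact fun l i => Real.exp_pos _
  · intro x hx
    funext i
    simp only [ψ, hΨφ, ofBall_toBall hr, hKJ]
    exact Real.exp_log (hx i)
  · ext l
    constructor
    · rintro ⟨x, hx, rfl⟩
      have hb := sumSq_toBall_lt hr (J fun i => Real.log (x i))
      refine ⟨⟨(hrb _ (hO hb)).1.2, ?_⟩, ?_⟩
      · change sumSq (Ψ (φ x)) < r ^ 2
        rw [hΨφ]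
        exact hb
      · rw [← sub_eq_zero, ← hΨF, hΨφ, toBall, map_smul, hDJ, smul_zero]
    · rintro ⟨⟨h1, h2⟩, h3⟩
      have h2' : sumSq (Ψ l) < r ^ 2 := h2
      have h4 : D (Ψ l) = 0 := by rw [hΨF, h3, sub_self]
      obtain ⟨y, hy⟩ := hJsurj (ofBall r (Ψ l)) (by rw [ofBall, map_smul, h4, smul_zero])
      refine ⟨fun i => Real.exp (y i), fun i => Real.exp_pos _, ?_⟩
      simp only [φ, Real.log_exp]
      rw [show (fun i => y i) = y from rfl, hy, toBall_ofBall hr h2', ← hP,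
        P.left_inv (hρb l h1).2]

end IsPermAction

end EquivariantChart

namespace TriangulatedSurface

variable (T : TriangulatedSurface.{u})

/-! ### The action of the automorphisms -/

theorem smul_edge_apply (f : T.autBdry) (l : T.Edge → ℝ) (d : T.Dart) :
    (f • l) (T.edge d) = l (T.edge ((f⁻¹).1 d)) := rfl

theorem smul_dart_apply (f : T.autBdry) (h : T.Dart → ℝ) (d : T.Dart) :
    (f • h) d = h ((f⁻¹).1 d) := rfl

theorem aut_rot (f : T.autBdry) (d : T.Dart) : f.1 (T.rot d) = T.rot (f.1 d) := f.2.1 d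

theorem aut_flip (f : T.autBdry) (d : T.Dart) : f.1 (T.flip d) = T.flip (f.1 d) := f.2.2.1 d

theorem aut_vertex (f : T.autBdry) (d : T.Dart) : T.vertex (f.1 d) = T.vertex d := f.2.2.2 d

theorem aut_next_pow (f : T.autBdry) (n : ℕ) (d : T.Dart) :
    f.1 ((T.next ^ n) d) = (T.next ^ n) (f.1 d) := by
  have h : ∀ d, f.1 (T.next d) = T.next (f.1 d) := fun d => by
    simp only [next, Equiv.Perm.mul_apply, T.rot_inv, T.aut_rot, T.aut_flip]
  induction n with
  | zero => rfl
  | succ n ih => rw [pow_succ', Equiv.Perm.mul_apply, h, ih, Equiv.Perm.mul_apply]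

theorem isPermAction_dart : IsPermAction T.autBdry (ι := T.Dart) := fun f =>
  ⟨(f⁻¹).1, fun _ => rfl⟩

theorem edgeMap_edge (f : T.autBdry) (d : T.Dart) : T.edgeMap f (T.edge d) = T.edge (f.1 d) := rfl

theorem isPermAction_edge : IsPermAction T.autBdry (ι := T.Edge) := fun f =>
  ⟨{ toFun := T.edgeMap f⁻¹
     invFun := T.edgeMap f
     left_inv := fun e => by
      obtain ⟨d, rfl⟩ := T.exists_edge_eq e
      simp [edgeMap_edge]
     right_inv := fun e => by
      obtain ⟨d, rfl⟩ := T.exists_edge_eq e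
      simp [edgeMap_edge] }, fun _ => rfl⟩

theorem smul_equilateral (f : T.autBdry) (a : ℝ) : f • T.equilateral a = T.equilateral a := rfl

theorem dualPolytope_smul (f : T.autBdry) (l : T.Edge → ℝ) :
    T.dualPolytope (f • l) = f • T.dualPolytope l := by
  funext d
  rw [smul_dart_apply]
  simp only [dualPolytope, smul_edge_apply, T.aut_rot]

theorem side_apply (d : T.Dart) (h : T.Dart → ℝ) : T.side d h = h d + h (T.flip d) := rfl

theorem side_smul (f : T.autBdry) (h : T.Dart → ℝ) (d : T.Dart) :
    T.side d (f • h) = T.side ((f⁻¹).1 d) h := by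
  simp only [side_apply, smul_dart_apply, T.aut_flip]

theorem sum_side_smul (f : T.autBdry) (h : T.Dart → ℝ) (k : T.Vertex) :
    ∑ d ∈ T.dartsAt k, T.side d (f • h) = ∑ d ∈ T.dartsAt k, T.side d h := by
  simp only [T.side_smul]
  refine Finset.sum_equiv (f⁻¹).1 (fun d => ?_) fun d _ => rfl
  rw [mem_dartsAt, mem_dartsAt, T.aut_vertex]

theorem IsRegge.smul {l : T.Edge → ℝ} (hl : T.IsRegge l) (f : T.autBdry) : T.IsRegge (f • l) := by
  intro d
  simpa only [smul_edge_apply, T.aut_rot] using hl ((f⁻¹).1 d)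

theorem IsIsoperimetric.smul {a : ℝ} {h : T.Dart → ℝ} (hh : T.IsIsoperimetric a h)
    (f : T.autBdry) : T.IsIsoperimetric a (f • h) := by
  refine fun k => ⟨by rw [T.sum_side_smul, (hh k).1], fun d hd => ?_⟩
  rw [T.side_smul]
  exact (hh k).2 _ (by rw [mem_dartsAt, T.aut_vertex]; exact (T.mem_dartsAt).1 hd)

/-! ### Regge triangulations are determined by their dual polytopes -/

/-- `2y² + 2z² ≥ (y + z)² > x²` by the triangle inequality. -/
theorem IsRegge.radicand_pos {l : T.Edge → ℝ} (hl : T.IsRegge l) (d : T.Dart) :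
    0 < 2 * l (T.edge (T.rot d)) ^ 2 + 2 * l (T.edge (T.rot (T.rot d))) ^ 2 - l (T.edge d) ^ 2 := by
  obtain ⟨h1, h2⟩ := hl d
  have h3 := (hl (T.rot d)).1
  have h4 := (hl (T.rot (T.rot d))).1
  nlinarith [sq_nonneg (l (T.edge (T.rot d)) - l (T.edge (T.rot (T.rot d))))]

/-- The length of the side `d` of a triangle in terms of the half-edges of its barycentric dual. -/
def sideOfDual (h : T.Dart → ℝ) (d : T.Dart) : ℝ :=
  √(8 * (h (T.rot d) ^ 2 + h (T.rot (T.rot d)) ^ 2) - 4 * h d ^ 2)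

/-- A left inverse of `dualPolytope`. -/
def primalLengths (h : T.Dart → ℝ) : T.Edge → ℝ :=
  -- For arbitrary `h` the two triangles at an edge may disagree on its length; the mean descends to
  -- edges and agrees with both on Regge polytopes.
  T.edgeLift (fun d => (T.sideOfDual h d + T.sideOfDual h (T.flip d)) / 2) fun d => by
    rw [T.flip_flip, add_comm]

theorem primalLengths_edge (h : T.Dart → ℝ) (d : T.Dart) :
    T.primalLengths h (T.edge d) = (T.sideOfDual h d + T.sideOfDual h (T.flip d)) / 2 := rfl

/-- The relations `36 h_x² = 2y² + 2z² - x²` and their rotations, solved for `x²`. -/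
theorem IsRegge.sideOfDual_sq {l : T.Edge → ℝ} (hl : T.IsRegge l) (d : T.Dart) :
    8 * (T.dualPolytope l (T.rot d) ^ 2 + T.dualPolytope l (T.rot (T.rot d)) ^ 2) -
      4 * T.dualPolytope l d ^ 2 = l (T.edge d) ^ 2 := by
  have h1 := hl.radicand_pos T d
  have h2 := hl.radicand_pos T (T.rot d)
  have h3 := hl.radicand_pos T (T.rot (T.rot d))
  simp only [T.rot_rot_rot] at h2 h3
  simp only [dualPolytope, halfEdgeLength, T.rot_rot_rot, div_pow]
  rw [Real.sq_sqrt h1.le, Real.sq_sqrt h2.le, Real.sq_sqrt h3.le]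
  ring

theorem IsRegge.sideOfDual_dualPolytope {l : T.Edge → ℝ} (hl : T.IsRegge l) (d : T.Dart) :
    T.sideOfDual (T.dualPolytope l) d = l (T.edge d) := by
  rw [sideOfDual, hl.sideOfDual_sq, Real.sqrt_sq (hl d).1.le]

theorem IsRegge.primalLengths_dualPolytope {l : T.Edge → ℝ} (hl : T.IsRegge l) :
    T.primalLengths (T.dualPolytope l) = l := by
  funext e
  obtain ⟨d, rfl⟩ := T.exists_edge_eq e
  rw [primalLengths_edge, hl.sideOfDual_dualPolytope, hl.sideOfDual_dualPolytope, edge_flip]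
  ring

theorem primalLengths_smul (f : T.autBdry) (h : T.Dart → ℝ) :
    T.primalLengths (f • h) = f • T.primalLengths h := by
  funext e
  obtain ⟨d, rfl⟩ := T.exists_edge_eq e
  simp only [primalLengths_edge, smul_edge_apply, sideOfDual, smul_dart_apply, T.aut_rot,
    T.aut_flip]

theorem continuous_dualPolytope : Continuous T.dualPolytope := by
  refine continuous_pi fun d => ?_
  simp only [dualPolytope, halfEdgeLength]
  fun_prop

/-- Continuity is global because the real square root is continuous, with value 0 on negative
numbers; so preimages of open sets are open without restriction to the image. -/
theorem continuous_primalLengths : Continuous T.primalLengths := by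
  refine continuous_pi fun e => ?_
  obtain ⟨d, rfl⟩ := T.exists_edge_eq e
  simp only [primalLengths_edge, sideOfDual]
  fun_prop

theorem IsRegge.contDiffAt_dualPolytope {l : T.Edge → ℝ} (hl : T.IsRegge l) {n : WithTop ℕ∞} :
    ContDiffAt ℝ n T.dualPolytope l := by
  rw [contDiffAt_pi]
  intro d
  have hc : ∀ e : T.Edge, ContDiffAt ℝ n (fun l : T.Edge → ℝ => l e) l := fun e =>
    (contDiff_apply ℝ ℝ e).contDiffAt
  have hr : ContDiffAt ℝ n (fun l : T.Edge → ℝ => 2 * l (T.edge (T.rot d)) ^ 2 +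
      2 * l (T.edge (T.rot (T.rot d))) ^ 2 - l (T.edge d) ^ 2) l :=
    ((contDiffAt_const.mul ((hc _).pow 2)).add (contDiffAt_const.mul ((hc _).pow 2))).sub
      ((hc _).pow 2)
  exact (hr.sqrt (hl.radicand_pos T d).ne').div_const 6

theorem IsRegge.contDiffAt_primalLengths {l : T.Edge → ℝ} (hl : T.IsRegge l) {n : WithTop ℕ∞} :
    ContDiffAt ℝ n T.primalLengths (T.dualPolytope l) := by
  rw [contDiffAt_pi]
  intro e
  obtain ⟨d, rfl⟩ := T.exists_edge_eq e
  have hc : ∀ d : T.Dart, ContDiffAt ℝ n (fun h : T.Dart → ℝ => h d) (T.dualPolytope l) :=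
    fun d => (contDiff_apply ℝ ℝ d).contDiffAt
  have hs : ∀ d : T.Dart, ContDiffAt ℝ n (fun h => T.sideOfDual h d) (T.dualPolytope l) := by
    intro d
    refine ContDiffAt.sqrt ?_ ?_
    · exact (contDiffAt_const.mul (((hc _).pow 2).add ((hc _).pow 2))).sub
        (contDiffAt_const.mul ((hc _).pow 2))
    · rw [hl.sideOfDual_sq]
      exact (pow_pos (hl d).1 2).ne'
  exact ((hs d).add (hs _)).div_const _

/-! ### The deformation spaces -/

/-- The type `δ` can be read off from `h`, so the union over all types imposes no condition. -/
theorem polytopeDeformations_eq (a : ℝ) :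
    T.polytopeDeformations a = T.dualPolytope '' T.reggeDeformations a := by
  ext h
  constructor
  · intro hh
    obtain ⟨δ, ⟨l, hl, rfl⟩, hi, -⟩ := Set.mem_iUnion.1 hh
    exact ⟨l, ⟨hl, hi⟩, rfl⟩
  · rintro ⟨l, hl, rfl⟩
    exact (T.dualDeformation a ⟨l, hl⟩).2

theorem smul_mem_reggeDeformations {a : ℝ} {l : T.Edge → ℝ} (hl : l ∈ T.reggeDeformations a)
    (f : T.autBdry) : f • l ∈ T.reggeDeformations a :=
  ⟨hl.1.smul T f, by rw [dualPolytope_smul]; exact hl.2.smul T f⟩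

theorem dualPolytope_primalLengths {a : ℝ} {h : T.Dart → ℝ} (hh : h ∈ T.polytopeDeformations a) :
    T.primalLengths h ∈ T.reggeDeformations a ∧ T.dualPolytope (T.primalLengths h) = h := by
  rw [polytopeDeformations_eq] at hh
  obtain ⟨l, hl, rfl⟩ := hh
  rw [hl.1.primalLengths_dualPolytope]
  exact ⟨hl, rfl⟩

/-- The map `dualPolytope` between the deformation spaces is a homeomorphism. -/
def dualHomeomorph (a : ℝ) : T.reggeDeformations a ≃ₜ T.polytopeDeformations a where
  toFun := T.dualDeformation a
  invFun h := ⟨T.primalLengths h.1, (T.dualPolytope_primalLengths h.2).1⟩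
  left_inv l := Subtype.ext (l.2.1.primalLengths_dualPolytope T)
  right_inv h := Subtype.ext (T.dualPolytope_primalLengths h.2).2
  continuous_toFun := (T.continuous_dualPolytope.comp continuous_subtype_val).subtype_mk _
  continuous_invFun := (T.continuous_primalLengths.comp continuous_subtype_val).subtype_mk _

theorem dualHomeomorph_rel_iff {a : ℝ} (l m : T.reggeDeformations a) :
    orbitSetoid T.autBdry (T.reggeDeformations a) l m ↔
      orbitSetoid T.autBdry (T.polytopeDeformations a) (T.dualHomeomorph a l)
        (T.dualHomeomorph a m) := by
  change (l.1 ∈ MulAction.orbit T.autBdry m.1) ↔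
    (T.dualPolytope l.1 ∈ MulAction.orbit T.autBdry (T.dualPolytope m.1))
  constructor
  · rintro ⟨f, hf⟩
    exact ⟨f, by simp only [← hf, dualPolytope_smul]⟩
  · rintro ⟨f, hf⟩
    refine ⟨f, ?_⟩
    have := congrArg T.primalLengths hf
    simpa only [primalLengths_smul, l.2.1.primalLengths_dualPolytope,
      m.2.1.primalLengths_dualPolytope] using this

/-- The homeomorphism of the deformation spaces modulo automorphisms. -/
def orbitHomeomorph (a : ℝ) : T.ReggeSpace a ≃ₜ T.PolytopeSpace a where
  toEquiv := Quotient.congr (T.dualHomeomorph a).toEquiv T.dualHomeomorph_rel_iff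
  continuous_toFun := Continuous.quotient_map' (T.dualHomeomorph a).continuous
    fun l m => (T.dualHomeomorph_rel_iff l m).1
  continuous_invFun := Continuous.quotient_map' (T.dualHomeomorph a).symm.continuous
    fun l m h => (T.dualHomeomorph_rel_iff _ _).2 (by simpa using h)

/-! ### The perimeters -/

/-- The perimeters of the dual polygons, as a linear map. -/
def perimeterL : (T.Dart → ℝ) →L[ℝ] (T.Vertex → ℝ) :=
  ContinuousLinearMap.pi fun k => ∑ d ∈ T.dartsAt k, T.side d

theorem perimeterL_apply (h : T.Dart → ℝ) (k : T.Vertex) :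
    T.perimeterL h k = ∑ d ∈ T.dartsAt k, T.side d h := by
  simp [perimeterL, sum_apply]

theorem perimeterL_smul (f : T.autBdry) (h : T.Dart → ℝ) :
    T.perimeterL (f • h) = T.perimeterL h := by
  funext k
  rw [perimeterL_apply, perimeterL_apply, sum_side_smul]

/-- The transpose of `perimeterL`: the half-edge `d` is part of one side of the polygon at its tail
and of one side of the polygon at its head. -/
theorem sum_mul_perimeterL (lam : T.Vertex → ℝ) (h : T.Dart → ℝ) :
    ∑ k, lam k * T.perimeterL h k =
      ∑ d, (lam (T.vertex d) + lam (T.vertex (T.flip d))) * h d := by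
  classical
  have e1 : ∑ k, lam k * T.perimeterL h k = ∑ d, lam (T.vertex d) * T.side d h := by
    rw [← Finset.sum_fiberwise (s := Finset.univ) (g := T.vertex)]
    refine Finset.sum_congr rfl fun k _ => ?_
    rw [perimeterL_apply, Finset.mul_sum]
    refine Finset.sum_congr (by ext d; simp [mem_dartsAt]) fun d hd => ?_
    rw [(T.mem_dartsAt).1 (by simpa [mem_dartsAt] using hd)]
  have e2 : ∑ d, lam (T.vertex d) * h (T.flip d) = ∑ d, lam (T.vertex (T.flip d)) * h d := by
    rw [← Equiv.sum_comp T.flip fun d => lam (T.vertex (T.flip d)) * h d]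
    simp [T.flip_flip]
  simp only [e1, side_apply, mul_add, add_mul, Finset.sum_add_distrib, e2]

theorem isRegge_equilateral {a : ℝ} (ha : 0 < a) : T.IsRegge (T.equilateral a) := fun _ =>
  ⟨ha, by simp only [equilateral]; linarith⟩

theorem dualPolytope_equilateral {a : ℝ} (ha : 0 < a) (d : T.Dart) :
    T.dualPolytope (T.equilateral a) d = √3 / 6 * a := by
  simp only [dualPolytope, equilateral, halfEdgeLength]
  rw [show 2 * a ^ 2 + 2 * a ^ 2 - a ^ 2 = 3 * a ^ 2 by ring, Real.sqrt_mul (by norm_num),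
    Real.sqrt_sq ha.le]
  ring

theorem side_equilateral {a : ℝ} (ha : 0 < a) (d : T.Dart) :
    T.side d (T.dualPolytope (T.equilateral a)) = √3 / 3 * a := by
  rw [side_apply, T.dualPolytope_equilateral ha, T.dualPolytope_equilateral ha]
  ring

theorem perimeterL_equilateral {a : ℝ} (ha : 0 < a) (k : T.Vertex) :
    T.perimeterL (T.dualPolytope (T.equilateral a)) k = √3 / 3 * a * T.q k := by
  simp only [perimeterL_apply, T.side_equilateral ha, Finset.sum_const, nsmul_eq_mul, q]
  ring

theorem fderiv_dualPolytope_equilateral {a : ℝ} (ha : 0 < a) (u : T.Edge → ℝ) (d : T.Dart) :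
    fderiv ℝ T.dualPolytope (T.equilateral a) u d = (6 * √3)⁻¹ *
      (2 * u (T.edge (T.rot d)) + 2 * u (T.edge (T.rot (T.rot d))) - u (T.edge d)) := by
  have hd : HasFDerivAt T.dualPolytope (fderiv ℝ T.dualPolytope (T.equilateral a))
      (T.equilateral a) :=
    (((T.isRegge_equilateral ha).contDiffAt_dualPolytope T (n := 1)).differentiableAt
      (by simp)).hasFDerivAt
  -- The derivative is computed along the line through `T.equilateral a` in the direction `u`, where
  -- each radicand is a polynomial in `t` with value `3 * a ^ 2` at 0.
  have hline : HasDerivAt (fun t : ℝ => T.equilateral a + t • u) u 0 := by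
    simpa using ((hasDerivAt_id (0 : ℝ)).smul_const u).const_add (T.equilateral a)
  have h1 : HasDerivAt (fun t : ℝ => T.dualPolytope (T.equilateral a + t • u))
      (fderiv ℝ T.dualPolytope (T.equilateral a) u) 0 := by
    refine HasFDerivAt.comp_hasDerivAt (x := (0 : ℝ)) (l := T.dualPolytope) ?_ hline
    simpa using hd
  have h2 := hasDerivAt_pi.1 h1 d
  refine h2.unique ?_
  have hc : ∀ e : T.Edge, HasDerivAt (fun t : ℝ => a + t * u e) (u e) 0 := fun e => by
    simpa using ((hasDerivAt_id (0 : ℝ)).mul_const (u e)).const_add a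
  have hr := (((hc (T.edge (T.rot d))).pow 2).const_mul 2).add
    (((hc (T.edge (T.rot (T.rot d)))).pow 2).const_mul 2) |>.sub ((hc (T.edge d)).pow 2)
  have h3 := (hr.sqrt (ne_of_gt (by simp; nlinarith [pow_pos ha 2]))).div_const 6
  refine h3.congr_deriv ?_
  have hs : √(2 * a ^ 2 + 2 * a ^ 2 - a ^ 2) = √3 * a := by
    rw [show 2 * a ^ 2 + 2 * a ^ 2 - a ^ 2 = 3 * a ^ 2 by ring, Real.sqrt_mul (by norm_num),
      Real.sqrt_sq ha.le]
  simp [hs]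
  field_simp

theorem surjective_fderiv_perimeter {a : ℝ} (ha : 0 < a) :
    Function.Surjective (fderiv ℝ (fun l => T.perimeterL (T.dualPolytope l)) (T.equilateral a)) := by
  have hd : HasFDerivAt T.dualPolytope (fderiv ℝ T.dualPolytope (T.equilateral a))
      (T.equilateral a) :=
    (((T.isRegge_equilateral ha).contDiffAt_dualPolytope T (n := 1)).differentiableAt
      (by simp)).hasFDerivAt
  rw [show fderiv ℝ (fun l => T.perimeterL (T.dualPolytope l)) (T.equilateral a) = _ from
    (T.perimeterL.hasFDerivAt.comp (T.equilateral a) hd).fderiv]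
  set D := T.perimeterL.comp (fderiv ℝ T.dualPolytope (T.equilateral a)) with hD
  by_contra hns
  -- A proper range is annihilated by a nonzero functional `θ`, whose coordinates are vertex weights
  -- in the cokernel.
  have hlt : LinearMap.range D.toLinearMap < ⊤ :=
    lt_top_iff_ne_top.2 fun h => hns (LinearMap.range_eq_top.1 h)
  obtain ⟨θ, hθ, hle⟩ := Submodule.exists_le_ker_of_lt_top _ hlt
  refine hθ ?_
  classical
  have hθs : ∀ v, θ v = ∑ k, θ (Pi.single k 1) * v k := fun v => by
    conv_lhs => rw [LinearMap.pi_apply_eq_sum_univ θ v]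
    refine Finset.sum_congr rfl fun k _ => ?_
    rw [smul_eq_mul, mul_comm]
    congr 2
    funext j
    simp [Pi.single_apply, eq_comm]
  have h0 := T.vertexWeight_eq_zero_of_orthogonal (fun k => θ (Pi.single k 1)) fun u => by
    have h1 : θ (D u) = 0 := hle ⟨u, rfl⟩
    rw [hθs, hD] at h1
    simp only [ContinuousLinearMap.comp_apply] at h1
    rw [sum_mul_perimeterL (T := T) (fun k => θ (Pi.single k 1))] at h1
    simp only [T.fderiv_dualPolytope_equilateral ha, mul_left_comm _ ((6 * √3)⁻¹),
      ← Finset.mul_sum] at h1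
    exact (mul_eq_zero.1 h1).resolve_left (by positivity)
  refine LinearMap.ext fun v => ?_
  rw [hθs]
  simp [fun k => congrFun h0 k]

/-! ### Neighbourhoods of the equilateral triangulation -/

theorem isOpen_isRegge : IsOpen {l | T.IsRegge l} := by
  simp only [IsRegge, Set.ofPred_forall]
  refine isOpen_iInter_of_finite fun d => ?_
  have hc : ∀ e : T.Edge, Continuous fun l : T.Edge → ℝ => l e := continuous_apply
  exact (isOpen_lt continuous_const (hc _)).inter (isOpen_lt (hc _) ((hc _).add (hc _)))

/-- At the equilateral point all strict inequalities hold, the bound on the sides because `√3/3 <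
(√3/6) q` for `q ≥ 3`. They persist nearby, leaving only the perimeter equations. -/
theorem eventually_mem_reggeDeformations_iff (hq : ∀ k, 3 ≤ T.q k) {a : ℝ} (ha : 0 < a) :
    ∀ᶠ l in 𝓝 (T.equilateral a), l ∈ T.reggeDeformations a ↔
      T.perimeterL (T.dualPolytope l) = T.perimeterL (T.dualPolytope (T.equilateral a)) := by
  have h1 : ∀ᶠ l in 𝓝 (T.equilateral a), T.IsRegge l :=
    T.isOpen_isRegge.mem_nhds (T.isRegge_equilateral ha)
  have hs : ∀ d, Continuous fun l => T.side d (T.dualPolytope l) := fun d =>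
    (T.side d).continuous.comp T.continuous_dualPolytope
  have h2 : ∀ᶠ l in 𝓝 (T.equilateral a), ∀ d, 0 < T.side d (T.dualPolytope l) ∧
      T.side d (T.dualPolytope l) < √3 / 6 * a * T.q (T.vertex d) := by
    rw [Filter.eventually_all]
    intro d
    have hq' : (3 : ℝ) ≤ T.q (T.vertex d) := by exact_mod_cast hq _
    have hpos : 0 < √3 * a := by positivity
    refine ((hs d).continuousAt.eventually_const_lt ?_).and
      ((hs d).continuousAt.eventually_lt_const ?_)
    · simp only [T.side_equilateral ha]; positivity
    · simp only [T.side_equilateral ha]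
      nlinarith
  filter_upwards [h1, h2] with l hl hl2
  constructor
  · rintro ⟨-, h⟩
    funext k
    rw [T.perimeterL_equilateral ha, perimeterL_apply, (h k).1]
  · intro h
    refine ⟨hl, fun k => ⟨?_, fun d hd => ?_⟩⟩
    · rw [← perimeterL_apply, h, T.perimeterL_equilateral ha]
    · have := hl2 d
      rw [(T.mem_dartsAt).1 hd] at this
      exact ⟨this.1, this.2.le⟩

theorem equilateral_mem_reggeDeformations (hq : ∀ k, 3 ≤ T.q k) {a : ℝ} (ha : 0 < a) :
    T.equilateral a ∈ T.reggeDeformations a :=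
  (T.eventually_mem_reggeDeformations_iff hq ha).self_of_nhds.2 rfl

end TriangulatedSurface

/-! ### Charts from smooth inverses -/

/-- A left inverse `ψ` that is smooth in the ambient space yields both the immersion and the
embedding property, and transports the action of `G` from `S` to the orthant. -/
theorem isOrbifoldChart_of_inverse {G E : Type*} [Group G] [NormedAddCommGroup E] [NormedSpace ℝ E]
    [MulAction G E] {S : Set E} {d : ℕ} {φ : (Fin d → ℝ) → E} {ψ : E → (Fin d → ℝ)}
    {act : G → (Fin d → ℝ) → (Fin d → ℝ)}
    (hact : ∀ g, ∀ x ∈ posOrthant d, act g x = ψ (g • φ x))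
    (hφ : ContDiffOn ℝ ∞ φ (posOrthant d)) (hψ : ∀ y ∈ S, ContDiffAt ℝ ∞ ψ y)
    (hψS : ∀ y ∈ S, ψ y ∈ posOrthant d) (hψφ : ∀ x ∈ posOrthant d, ψ (φ x) = x)
    (himage : φ '' posOrthant d = S) (hS : ∀ g : G, ∀ y ∈ S, g • y ∈ S)
    (hG : ∀ g : G, ContDiff ℝ ∞ fun y : E => g • y) : IsOrbifoldChart S act φ := by
  have hφS : ∀ x ∈ posOrthant d, φ x ∈ S := fun x hx => himage ▸ Set.mem_image_of_mem φ hx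
  have hφψ : ∀ y ∈ S, φ (ψ y) = y := by
    intro y hy
    rw [← himage] at hy
    obtain ⟨x, hx, rfl⟩ := hy
    rw [hψφ x hx]
  have hφat : ∀ x ∈ posOrthant d, ContDiffAt ℝ ∞ φ x := fun x hx =>
    hφ.contDiffAt ((isOpen_posOrthant d).mem_nhds hx)
  have hmem : ∀ g, ∀ x ∈ posOrthant d, act g x ∈ posOrthant d := fun g x hx => by
    rw [hact g x hx]
    exact hψS _ (hS g _ (hφS x hx))
  have hequiv : ∀ g, ∀ x ∈ posOrthant d, φ (act g x) = g • φ x := fun g x hx => by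
    rw [hact g x hx, hφψ _ (hS g _ (hφS x hx))]
  refine ⟨⟨hmem, fun g => ?_, fun x hx => ?_, fun g h x hx => ?_⟩, hφ, fun x hx => ?_, ?_,
    himage, hequiv⟩
  · refine ContDiffOn.congr (f := fun x => ψ (g • φ x)) (fun x hx => ?_) (hact g)
    have h1 : ContDiffAt ℝ ∞ (fun x => g • φ x) x := (hG g).contDiffAt.comp x (hφat x hx)
    exact ((hψ _ (hS g _ (hφS x hx))).comp x h1).contDiffWithinAt
  · rw [hact 1 x hx, one_smul, hψφ x hx]
  · rw [hact _ x hx, hact g _ (hmem h x hx), hequiv h x hx, mul_smul]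
  · have h1 := ((hφat x hx).differentiableAt (by simp)).hasFDerivAt
    have h2 := ((hψ _ (hφS x hx)).differentiableAt (by simp)).hasFDerivAt
    have h3 : HasFDerivAt (fun x => ψ (φ x)) (ContinuousLinearMap.id ℝ (Fin d → ℝ)) x := by
      refine (hasFDerivAt_id x).congr_of_eventuallyEq ?_
      filter_upwards [(isOpen_posOrthant d).mem_nhds hx] with y hy using hψφ y hy
    have h4 := (h2.comp x h1).unique h3
    exact Function.LeftInverse.injective (g := fderiv ℝ ψ (φ x)) fun v =>
      congrArg (fun A : (Fin d → ℝ) →L[ℝ] (Fin d → ℝ) => A v) h4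
  · let f : posOrthant d → S := fun x => ⟨φ x, hφS x x.2⟩
    let k : S → posOrthant d := fun y => ⟨ψ y, hψS y y.2⟩
    have hf : Continuous f :=
      (continuousOn_iff_continuous_domRestrict.1 hφ.continuousOn).subtype_mk _
    have hk : Continuous k := (continuousOn_iff_continuous_domRestrict.1
      (fun y hy => (hψ y hy).continuousAt.continuousWithinAt : ContinuousOn ψ S)).subtype_mk _
    have hkf : Function.LeftInverse k f := fun x => Subtype.ext (hψφ x x.2)
    exact Topology.IsEmbedding.subtypeVal.comp (hkf.isEmbedding hk hf)

/-! ### Pullbacks of constant forms -/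

section Forms

variable {E F : Type*} [NormedAddCommGroup E] [NormedSpace ℝ E] [NormedAddCommGroup F]
  [NormedSpace ℝ F]

theorem wedge_comp (f g : E →L[ℝ] ℝ) (A : F →L[ℝ] E) :
    (wedge f g).compContinuousLinearMap A = wedge (f.comp A) (g.comp A) := by
  ext v
  simp [wedge_apply]

/-- The pullback is the wedge of the covectors `f ∘ dΘ` and `g ∘ dΘ`, which depend smoothly on the
point. -/
theorem contDiffOn_pullbackForm_wedge (f g : E →L[ℝ] ℝ) {Θ : F → E} {s : Set F} (hs : IsOpen s)
    (hΘ : ContDiffOn ℝ ∞ Θ s) : ContDiffOn ℝ ∞ (pullbackForm Θ fun _ => wedge f g) s := by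
  have hd : ContDiffOn ℝ ∞ (fderiv ℝ Θ) s := hΘ.fderiv_of_isOpen hs (by simp)
  have hf : ∀ f : E →L[ℝ] ℝ, ContDiffOn ℝ ∞ (fun x => f.comp (fderiv ℝ Θ x)) s := fun f =>
    contDiffOn_const.clm_comp hd
  have h1 : ContDiffOn ℝ ∞ (fun x => (f.comp (fderiv ℝ Θ x)).smulRight
      (ContinuousAlternatingMap.ofSubsingletonLIE (𝕜 := ℝ) (E := F) (F := ℝ) (0 : Fin 1)
        (g.comp (fderiv ℝ Θ x)))) s :=
    (hf f).smulRight ((LinearIsometryEquiv.contDiff _).comp_contDiffOn (hf g))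
  have h2 := (ContinuousAlternatingMap.alternatizeUncurryFinCLM ℝ F ℝ
    (n := 1)).contDiff.comp_contDiffOn h1
  refine h2.congr fun x _ => ?_
  exact wedge_comp f g _

theorem contDiffOn_pullbackForm_sum {ι : Type*} (t : Finset ι) (c : ι → E [⋀^Fin 2]→L[ℝ] ℝ)
    {Θ : F → E} {s : Set F}
    (h : ∀ i ∈ t, ContDiffOn ℝ ∞ (pullbackForm Θ fun _ => c i) s) :
    ContDiffOn ℝ ∞ (pullbackForm Θ fun _ => ∑ i ∈ t, c i) s := by
  refine (ContDiffOn.sum h).congr fun x _ => ?_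
  ext v
  simp [pullbackForm]

theorem contDiffOn_pullbackForm_smul (r : ℝ) (c : E [⋀^Fin 2]→L[ℝ] ℝ) {Θ : F → E} {s : Set F}
    (h : ContDiffOn ℝ ∞ (pullbackForm Θ fun _ => c) s) :
    ContDiffOn ℝ ∞ (pullbackForm Θ fun _ => r • c) s := by
  refine (contDiffOn_const (c := r) |>.smul h).congr fun x _ => ?_
  ext v
  simp [pullbackForm]

/-- The exterior derivative commutes with pullback, and a constant form is closed. -/
theorem extDeriv_pullbackForm_const (c : E [⋀^Fin 2]→L[ℝ] ℝ) {Θ : F → E} {x : F}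
    (hΘ : ContDiffAt ℝ ∞ Θ x) : extDeriv (pullbackForm Θ fun _ => c) x = 0 := by
  have hc : DifferentiableAt ℝ (fun _ : E => c) (Θ x) := differentiableAt_const c
  have h2 : (2 : WithTop ℕ∞) ≤ ∞ := WithTop.coe_le_coe.2 (le_top : (2 : ℕ∞) ≤ ⊤)
  refine (extDeriv_pullback hc hΘ (by simpa using h2)).trans ?_
  ext v
  simp [extDeriv, ContinuousAlternatingMap.alternatizeUncurryFin_apply]

end Forms

/-! ### The curvature forms -/

/-- The sum of the cross products with increasing indices does not change under a cyclic shift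
when the totals vanish. -/
theorem sum_cross_shift (x y : ℕ → ℝ) (n : ℕ) (hx : ∑ i ∈ Finset.range (n + 1), x i = 0)
    (hy : ∑ i ∈ Finset.range (n + 1), y i = 0) :
    ∑ β ∈ Finset.range n, ∑ α ∈ Finset.range (β + 1),
        (x (α + 1) * y (β + 1) - x (β + 1) * y (α + 1)) =
      ∑ β ∈ Finset.range n, ∑ α ∈ Finset.range (β + 1), (x α * y β - x β * y α) := by
  let X : ℕ → ℝ := fun k => ∑ i ∈ Finset.range k, x i
  let Y : ℕ → ℝ := fun k => ∑ i ∈ Finset.range k, y i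
  -- The inner sums in terms of partial sums. `f` vanishes at 0 by antisymmetry and at `n` by the
  -- vanishing totals, so its sum is unchanged by a shift; the terms with index 0 that the shift
  -- loses add up to `x 0 * y 0 - x 0 * y 0` up to sign.
  let f : ℕ → ℝ := fun β => X (β + 1) * y β - x β * Y (β + 1)
  have hsx : ∑ i ∈ Finset.range n, x (i + 1) = -x 0 := by
    rw [Finset.sum_range_succ'] at hx; linarith
  have hsy : ∑ i ∈ Finset.range n, y (i + 1) = -y 0 := by
    rw [Finset.sum_range_succ'] at hy; linarith
  have hf0 : f 0 = 0 := by simp [f, X, Y]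
  have hfn : f n = 0 := by simp only [f, X, Y, hx, hy]; ring
  have e1 : ∑ β ∈ Finset.range n, f β = ∑ β ∈ Finset.range n, f (β + 1) := by
    have h1 := Finset.sum_range_succ f n
    have h2 := Finset.sum_range_succ' f n
    linarith
  have e2 : ∀ β, ∑ α ∈ Finset.range (β + 1), (x α * y β - x β * y α) = f β := fun β => by
    simp only [f, X, Y, Finset.sum_sub_distrib, Finset.sum_mul, Finset.mul_sum]
  have e3 : ∀ β, ∑ α ∈ Finset.range (β + 1), (x (α + 1) * y (β + 1) - x (β + 1) * y (α + 1)) =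
      f (β + 1) - (x 0 * y (β + 1) - x (β + 1) * y 0) := fun β => by
    rw [Finset.sum_sub_distrib, ← Finset.sum_mul, ← Finset.mul_sum]
    have h1 := Finset.sum_range_succ' x (β + 1)
    have h2 := Finset.sum_range_succ' y (β + 1)
    simp only [f, X, Y, h1, h2]
    ring
  simp only [e2, e3, Finset.sum_sub_distrib, ← Finset.mul_sum, ← Finset.sum_mul, hsx, hsy, e1]
  ring

namespace TriangulatedSurface

variable (T : TriangulatedSurface.{u})

/-- The first `q` iterates of `next` list each dart at the vertex exactly once. -/
theorem sum_sideAt (d : T.Dart) (h : T.Dart → ℝ) :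
    ∑ α ∈ Finset.range (T.q (T.vertex d)), T.sideAt d α h = T.perimeterL h (T.vertex d) := by
  classical
  have hc := T.isCycleOn_dartsAt (T.vertex d)
  have hd : d ∈ T.dartsAt (T.vertex d) := T.mem_dartsAt.2 rfl
  rw [perimeterL_apply]
  refine Finset.sum_nbij (fun α => (T.next ^ α) d) (fun α _ => ?_) (fun α hα β hβ h => ?_)
    (fun e he => ?_) fun α _ => rfl
  · have h : ∀ n, T.vertex ((T.next ^ n) d) = T.vertex d := fun n => by
      induction n with
      | zero => rfl
      | succ n ih => rw [pow_succ', Equiv.Perm.mul_apply, T.vertex_next, ih]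
    exact T.mem_dartsAt.2 (h α)
  · have := (hc.pow_apply_eq_pow_apply hd).1 h
    simp only [Finset.coe_range, Set.mem_Iio] at hα hβ
    exact this.eq_of_lt_of_lt hα hβ
  · obtain ⟨n, hn, rfl⟩ := hc.exists_pow_eq hd he
    exact ⟨n, Finset.mem_coe.2 (Finset.mem_range.2 hn), rfl⟩

theorem varpi_apply (a : ℝ) (d : T.Dart) (m : Fin 2 → T.Dart → ℝ) :
    T.varpi a d m = ((√3 / 3 * a * T.q (T.vertex d)) ^ 2)⁻¹ *
      ∑ β ∈ Finset.range (T.q (T.vertex d) - 1), ∑ α ∈ Finset.range (β + 1),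
        (T.sideAt d α (m 0) * T.sideAt d β (m 1) - T.sideAt d β (m 0) * T.sideAt d α (m 1)) := by
  simp only [varpi, ContinuousAlternatingMap.smul_apply, ContinuousAlternatingMap.sum_apply,
    wedge_apply, smul_eq_mul]
  congr 1
  refine Finset.sum_congr rfl fun β _ => Finset.sum_congr rfl fun α _ => ?_
  ring

theorem one_le_q (d : T.Dart) : 1 ≤ T.q (T.vertex d) :=
  Finset.card_pos.2 ⟨d, T.mem_dartsAt.2 rfl⟩

theorem varpi_next (a : ℝ) (d : T.Dart) {m : Fin 2 → T.Dart → ℝ}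
    (hm : ∀ i, T.perimeterL (m i) = 0) : T.varpi a (T.next d) m = T.varpi a d m := by
  rw [varpi_apply, varpi_apply, T.vertex_next]
  have hs : ∀ α h, T.sideAt (T.next d) α h = T.sideAt d (α + 1) h := fun α h => by
    rw [sideAt, sideAt, pow_succ, Equiv.Perm.mul_apply]
  simp only [hs]
  congr 1
  have hq := T.one_le_q d
  -- Here `n = q - 1`: the form omits the last side, while the vanishing totals run over all `q`
  -- sides.
  refine sum_cross_shift (fun α => T.sideAt d α (m 0)) (fun α => T.sideAt d α (m 1)) _ ?_ ?_ <;>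
  · rw [Nat.sub_add_cancel hq, T.sum_sideAt, hm]
    rfl

theorem varpi_eq_of_vertex_eq (a : ℝ) {d e : T.Dart} (hde : T.vertex d = T.vertex e)
    {m : Fin 2 → T.Dart → ℝ} (hm : ∀ i, T.perimeterL (m i) = 0) :
    T.varpi a d m = T.varpi a e m := by
  obtain ⟨n, -, rfl⟩ := (T.isCycleOn_dartsAt (T.vertex d)).exists_pow_eq
    (T.mem_dartsAt.2 rfl) (T.mem_dartsAt.2 hde.symm)
  clear hde
  induction n with
  | zero => rfl
  | succ n ih => rw [pow_succ', Equiv.Perm.mul_apply, T.varpi_next a _ hm, ih]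

/-- Automorphisms commute with `next`, so they keep the counterclockwise order and only move the
first side. -/
theorem varpi_smul (a : ℝ) (d : T.Dart) (f : T.autBdry) (m : Fin 2 → T.Dart → ℝ) :
    T.varpi a d (fun i => f • m i) = T.varpi a ((f⁻¹).1 d) m := by
  have hs : ∀ α h, T.sideAt d α (f • h) = T.sideAt ((f⁻¹).1 d) α h := fun α h => by
    rw [sideAt, side_smul, T.aut_next_pow, sideAt]
  simp only [varpi_apply, hs, T.aut_vertex]

theorem Omega_apply (a : ℝ) (s : T.Vertex → T.Dart) (m : Fin 2 → T.Dart → ℝ) :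
    T.Omega a s m = ∑ k, (√3 / 3 * a * T.q k) ^ 2 * T.varpi a (s k) m := by
  simp [Omega, ContinuousAlternatingMap.sum_apply]

/-- On deformations that preserve the perimeters, `Omega` does not depend on the first sides. -/
theorem Omega_eq_of_section (a : ℝ) {s t : T.Vertex → T.Dart} (hs : ∀ k, T.vertex (s k) = k)
    (ht : ∀ k, T.vertex (t k) = k) {m : Fin 2 → T.Dart → ℝ}
    (hm : ∀ i, T.perimeterL (m i) = 0) : T.Omega a s m = T.Omega a t m := by
  simp only [Omega_apply]
  refine Finset.sum_congr rfl fun k _ => ?_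
  rw [T.varpi_eq_of_vertex_eq a ((hs k).trans (ht k).symm) hm]

theorem Omega_smul (a : ℝ) {s : T.Vertex → T.Dart} (hs : ∀ k, T.vertex (s k) = k)
    (f : T.autBdry) {m : Fin 2 → T.Dart → ℝ} (hm : ∀ i, T.perimeterL (m i) = 0) :
    T.Omega a s (fun i => f • m i) = T.Omega a s m := by
  rw [← T.Omega_eq_of_section a (s := fun k => (f⁻¹).1 (s k)) (t := s)
    (fun k => by rw [T.aut_vertex, hs]) hs hm]
  simp only [Omega_apply, varpi_smul]

/-- The pullback of `Omega` under an equivariant parametrization of isoperimetric polytopes is a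
closed form on the orbifold, which does not depend on the first sides. -/
theorem isClosedOrbifoldForm_pullbackForm_Omega (a : ℝ) {s : T.Vertex → T.Dart}
    (hs : ∀ k, T.vertex (s k) = k) {S : Set (T.Dart → ℝ)} {d : ℕ}
    {act : T.autBdry → (Fin d → ℝ) → (Fin d → ℝ)} {Θ : (Fin d → ℝ) → (T.Dart → ℝ)}
    (hΘ : IsOrbifoldChart S act Θ) (hS : S ⊆ T.polytopeDeformations a) :
    IsClosedOrbifoldForm act (pullbackForm Θ fun _ => T.Omega a s) ∧
    ∀ t : T.Vertex → T.Dart, (∀ k, T.vertex (t k) = k) →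
      Set.EqOn (pullbackForm Θ fun _ => T.Omega a t) (pullbackForm Θ fun _ => T.Omega a s)
        (posOrthant d) := by
  have hΘat : ∀ x ∈ posOrthant d, ContDiffAt ℝ ∞ Θ x := fun x hx =>
    hΘ.smooth.contDiffAt ((isOpen_posOrthant d).mem_nhds hx)
  have hΘd : ∀ x ∈ posOrthant d, HasFDerivAt Θ (fderiv ℝ Θ x) x := fun x hx =>
    ((hΘat x hx).differentiableAt (by simp)).hasFDerivAt
  -- The perimeters are constant on isoperimetric polytopes, so tangent vectors have zero
  -- perimeters; this is what independence of the first sides requires.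
  have hper : ∀ x ∈ posOrthant d, ∀ v, T.perimeterL (fderiv ℝ Θ x v) = 0 := by
    intro x hx v
    have h1 : HasFDerivAt (fun x => T.perimeterL (Θ x)) (T.perimeterL.comp (fderiv ℝ Θ x)) x :=
      T.perimeterL.hasFDerivAt.comp x (hΘd x hx)
    have h2 : HasFDerivAt (fun x => T.perimeterL (Θ x))
        (0 : (Fin d → ℝ) →L[ℝ] (T.Vertex → ℝ)) x := by
      refine (hasFDerivAt_const (fun k => √3 / 3 * a * T.q k) x).congr_of_eventuallyEq ?_
      filter_upwards [(isOpen_posOrthant d).mem_nhds hx] with y hy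
      have hy' : Θ y ∈ T.polytopeDeformations a := hS (hΘ.image_eq ▸ Set.mem_image_of_mem Θ hy)
      obtain ⟨δ, -, hi, -⟩ := Set.mem_iUnion.1 hy'
      funext k
      rw [perimeterL_apply, (hi k).1]
    exact congrArg (fun A : (Fin d → ℝ) →L[ℝ] (T.Vertex → ℝ) => A v) (h1.unique h2)
  refine ⟨⟨?_, fun f x hx => ?_, fun x hx => extDeriv_pullbackForm_const _ (hΘat x hx)⟩,
    fun t ht x hx => ?_⟩
  · refine contDiffOn_pullbackForm_sum _ _ fun k _ => contDiffOn_pullbackForm_smul _ _ ?_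
    refine contDiffOn_pullbackForm_smul _ _ ?_
    refine contDiffOn_pullbackForm_sum _ _ fun β _ => contDiffOn_pullbackForm_sum _ _ fun α _ => ?_
    exact contDiffOn_pullbackForm_wedge _ _ (isOpen_posOrthant d) hΘ.smooth
  · have hfx := hΘ.isSmoothAction.mapsTo f hx
    have hA : HasFDerivAt (act f) (fderiv ℝ (act f) x) x :=
      (((hΘ.isSmoothAction.smooth f).contDiffAt
        ((isOpen_posOrthant d).mem_nhds hx)).differentiableAt (by simp)).hasFDerivAt
    obtain ⟨L, hL⟩ := T.isPermAction_dart.exists_linear f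
    have h1 : HasFDerivAt (fun x => Θ (act f x))
        ((fderiv ℝ Θ (act f x)).comp (fderiv ℝ (act f) x)) x := (hΘd _ hfx).comp x hA
    have h2 : HasFDerivAt (fun x => Θ (act f x)) (L.comp (fderiv ℝ Θ x)) x := by
      refine (L.hasFDerivAt.comp x (hΘd x hx)).congr_of_eventuallyEq ?_
      filter_upwards [(isOpen_posOrthant d).mem_nhds hx] with y hy
      rw [hΘ.equivariant f y hy, hL]
      rfl
    have h3 : ∀ v, fderiv ℝ Θ (act f x) (fderiv ℝ (act f) x v) = f • fderiv ℝ Θ x v := fun v => by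
      rw [hL]
      exact congrArg (fun A : (Fin d → ℝ) →L[ℝ] (T.Dart → ℝ) => A v) (h1.unique h2)
    ext m
    change T.Omega a s (fun i => fderiv ℝ Θ (act f x) (fderiv ℝ (act f) x (m i))) =
      T.Omega a s (fun i => fderiv ℝ Θ x (m i))
    simp only [h3]
    exact T.Omega_smul a hs f fun i => hper x hx (m i)
  · ext m
    exact T.Omega_eq_of_section a ht hs fun i => hper x hx (m i)

end TriangulatedSurface

end

/-! ### Assembly of the homeomorphism, the charts and the form -/

theorem proposition8 (T : TriangulatedSurface.{u}) (g : ℕ) (hg : T.HasGenus g)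
    (hq : ∀ k, 3 ≤ T.q k) (a : ℝ) (ha : 0 < a) :
    (∃ Φ : T.ReggeSpace a ≃ₜ T.PolytopeSpace a,
      ∀ l : T.reggeDeformations a,
        Φ (Quotient.mk _ l) = Quotient.mk _ (T.dualDeformation a l)) ∧
    ((T.N₁ - T.N₀ : ℕ) : ℤ) = 2 * T.N₀ + 6 * g - 6 ∧
    T.equilateral a ∈ T.reggeDeformations a ∧
    ∀ U ∈ 𝓝 (T.equilateral a), ∃ W : Set (T.Edge → ℝ), ∃ V : Set (T.Dart → ℝ),
      W ⊆ U ∧ IsOpen W ∧ T.equilateral a ∈ W ∧ (∀ f : T.autBdry, ∀ l ∈ W, f • l ∈ W) ∧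
      IsOpen V ∧ (∀ f : T.autBdry, ∀ h ∈ V, f • h ∈ V) ∧
      T.dualPolytope '' (T.reggeDeformations a ∩ W) = T.polytopeDeformations a ∩ V ∧
      ∃ (act : T.autBdry → (Fin (T.N₁ - T.N₀) → ℝ) → (Fin (T.N₁ - T.N₀) → ℝ))
        (φ : (Fin (T.N₁ - T.N₀) → ℝ) → (T.Edge → ℝ))
        (η : (Fin (T.N₁ - T.N₀) → ℝ) → (Fin (T.N₁ - T.N₀) → ℝ) [⋀^Fin 2]→L[ℝ] ℝ),
        IsOrbifoldChart (T.reggeDeformations a ∩ W) act φ ∧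
        IsOrbifoldChart (T.polytopeDeformations a ∩ V) act (T.dualPolytope ∘ φ) ∧
        IsClosedOrbifoldForm act η ∧
        ∀ s : T.Vertex → T.Dart, (∀ k, T.vertex (s k) = k) →
          Set.EqOn (pullbackForm (T.dualPolytope ∘ φ) fun _ => T.Omega a s) η
            (posOrthant (T.N₁ - T.N₀)) ∧
          Set.EqOn (pullbackForm φ (pullbackForm T.dualPolytope fun _ => T.Omega a s)) η
            (posOrthant (T.N₁ - T.N₀)) := by
  have he₀ := T.equilateral_mem_reggeDeformations hq ha
  refine ⟨⟨T.orbitHomeomorph a, fun l => rfl⟩, T.N₁_sub_N₀ hg hq, he₀, fun U hU => ?_⟩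
  have hreg := T.isRegge_equilateral ha
  have hF : ContDiffAt ℝ ω (fun l => T.perimeterL (T.dualPolytope l)) (T.equilateral a) :=
    T.perimeterL.contDiff.contDiffAt.comp _ (hreg.contDiffAt_dualPolytope T)
  obtain ⟨W, φ, ψ, hWN, hWo, hW₀, hWG, hφ, hψ, hψm, hψφ, hφim⟩ :=
    T.isPermAction_edge.exists_chart (fun f => T.smul_equilateral f a) hF
      (fun f l => by rw [T.dualPolytope_smul, T.perimeterL_smul])
      (T.surjective_fderiv_perimeter ha)
      -- Shrinking also to the neighbourhood where being a deformation is equivalent to the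
      -- perimeter equations identifies the level set with `T.reggeDeformations a ∩ W`.
      (Filter.inter_mem hU (T.eventually_mem_reggeDeformations_iff hq ha))
      (d := T.N₁ - T.N₀) (Nat.add_sub_of_le (T.N₀_le_N₁ hq))
  have hS : φ '' posOrthant (T.N₁ - T.N₀) = T.reggeDeformations a ∩ W := by
    rw [hφim]
    ext l
    exact ⟨fun h => ⟨(hWN h.1).2.2 h.2, h.1⟩, fun h => ⟨h.2, (hWN h.2).2.1 h.1⟩⟩
  have hφS : ∀ x ∈ posOrthant (T.N₁ - T.N₀), φ x ∈ T.reggeDeformations a ∩ W := fun x hx =>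
    hS ▸ Set.mem_image_of_mem φ hx
  -- `V` is the preimage of `W` under the left inverse: open by continuity, invariant by
  -- equivariance.
  have himage : T.dualPolytope '' (T.reggeDeformations a ∩ W) =
      T.polytopeDeformations a ∩ T.primalLengths ⁻¹' W := by
    rw [T.polytopeDeformations_eq]
    ext h
    constructor
    · rintro ⟨l, ⟨hl, hlW⟩, rfl⟩
      refine ⟨⟨l, hl, rfl⟩, ?_⟩
      rwa [Set.mem_preimage, hl.1.primalLengths_dualPolytope]
    · rintro ⟨⟨l, hl, rfl⟩, hlW⟩
      rw [Set.mem_preimage, hl.1.primalLengths_dualPolytope] at hlW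
      exact ⟨l, ⟨hl, hlW⟩, rfl⟩
  have hVG : ∀ f : T.autBdry, ∀ h ∈ T.primalLengths ⁻¹' W, f • h ∈ T.primalLengths ⁻¹' W :=
    fun f h hh => by
      rw [Set.mem_preimage, T.primalLengths_smul]
      exact hWG f _ hh
  have hchart : IsOrbifoldChart (T.reggeDeformations a ∩ W)
      (fun (f : T.autBdry) x => ψ (f • φ x)) φ :=
    isOrbifoldChart_of_inverse (fun _ _ _ => rfl) hφ
      (fun l hl => hψ.contDiffAt (hWo.mem_nhds hl.2)) (fun l _ => hψm l) hψφ hS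
      (fun f l hl => ⟨T.smul_mem_reggeDeformations hl.1 f, hWG f l hl.2⟩)
      T.isPermAction_edge.contDiff_smul
  have hdual : ContDiffOn ℝ ∞ (T.dualPolytope ∘ φ) (posOrthant (T.N₁ - T.N₀)) := fun x hx =>
    ((hφS x hx).1.1.contDiffAt_dualPolytope T).comp_contDiffWithinAt x (hφ x hx)
  have hchart' : IsOrbifoldChart (T.polytopeDeformations a ∩ T.primalLengths ⁻¹' W)
      (fun (f : T.autBdry) x => ψ (f • φ x)) (T.dualPolytope ∘ φ) := by
    -- The inverse chart for polytopes factors through `primalLengths`, so the same action on the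
    -- orthant serves both charts.
    refine isOrbifoldChart_of_inverse (ψ := ψ ∘ T.primalLengths) (fun f x hx => ?_) hdual
      (fun h hh => ?_) (fun h _ => hψm _) (fun x hx => ?_) (by rw [Set.image_comp, hS, himage])
      (fun f h hh => ?_) T.isPermAction_dart.contDiff_smul
    · simp only [Function.comp_apply, T.primalLengths_smul,
        (hφS x hx).1.1.primalLengths_dualPolytope]
    · rw [← himage] at hh
      obtain ⟨l, ⟨hl, hlW⟩, rfl⟩ := hh
      refine ContDiffAt.comp _ ?_ (hl.1.contDiffAt_primalLengths T)
      rw [hl.1.primalLengths_dualPolytope]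
      exact hψ.contDiffAt (hWo.mem_nhds hlW)
    · simp only [Function.comp_apply, (hφS x hx).1.1.primalLengths_dualPolytope, hψφ x hx]
    · refine ⟨?_, hVG f h hh.2⟩
      have h1 := hh.1
      rw [T.polytopeDeformations_eq] at h1 ⊢
      obtain ⟨l, hl, rfl⟩ := h1
      exact ⟨f • l, T.smul_mem_reggeDeformations hl f, T.dualPolytope_smul f l⟩
  obtain ⟨s₀, hs₀⟩ : ∃ s : T.Vertex → T.Dart, ∀ k, T.vertex (s k) = k :=
    ⟨Quotient.out, fun k => Quotient.out_eq k⟩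
  obtain ⟨hclosed, hsec⟩ := T.isClosedOrbifoldForm_pullbackForm_Omega a hs₀ hchart'
    Set.inter_subset_left
  refine ⟨W, T.primalLengths ⁻¹' W, fun l hl => (hWN hl).1, hWo, hW₀, hWG,
    hWo.preimage T.continuous_primalLengths, hVG, himage, fun f x => ψ (f • φ x), φ, _,
    hchart, hchart', hclosed, fun s hs => ⟨hsec s hs, fun x hx => ?_⟩⟩
  rw [← hsec s hs hx]
  -- Pulling back in two stages agrees with pulling back along the composite, by the chain rule.
  have h1 := ((hφ.contDiffAt ((isOpen_posOrthant _).mem_nhds hx)).differentiableAt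
    (by simp)).hasFDerivAt
  have h2 := (((hφS x hx).1.1.contDiffAt_dualPolytope T (n := 1)).differentiableAt
    (by simp)).hasFDerivAt
  ext m
  simp only [pullbackForm, (h2.comp x h1).fderiv]
  rfl
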